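/- Let $X$ be a Stein manifold of complex dimension $n$, i.e. a (Hausdorff, second countable) complex manifold that is holomorphically convex (the holomorphically convex hull of every compact set is compact), whose global holomorphic functions separate points, and such that around every point some $n$ global holomorphic functions form a local coordinate system. A *smooth strictly plurisubharmonic exhaustion* of $X$ is a smooth function $\phi:X\to\mathbb R$ whose Levi form $\sum_{j,k}\frac{\partial^2\phi}{\partial z_j\partial\bar z_k}w_j\bar w_k$ is positive definite at every point and for which all sets $\{\phi<c\}$, $c\in\mathbb R$, are relatively compact. Put $d^c\phi(v)=d\phi(Jv)$, where $J$ is the complex structure, $\theta_\phi=-d^c\phi$ and $\omega_\phi=d\theta_\phi=-dd^c\phi$. For an exact symplectic manifold $(M,\omega=d\theta)$, the Liouville vector field $Z$ is defined by $\omega(Z,\cdot)=\theta$. It is a *Liouville manifold* if the flow of $Z$ exists for all time and there is an exhausting function $h$ (smooth, proper, bounded below) and a sequence $c_k\to+\infty$ with $dh(Z)>0$ along $h^{-1}(c_k)$ for all $k$; it is *of finite type* if, moreover, $h$ can be chosen with $dh(Z)>0$ outside a compact set. Then: 1. For every smooth strictly plurisubharmonic exhaustion $\phi$ of $X$, $\omega_\phi$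 is an exact symplectic form with smooth primitive $\theta_\phi$, $\phi$ is an exhausting function, and the Liouville vector field $Z_\phi$ of $\theta_\phi$ satisfies $d\phi(Z_\phi)>0$ along $\phi^{-1}(c_k)$ for some sequence $c_k\to+\infty$; if the critical set of $\phi$ is compact, then $d\phi(Z_\phi)>0$ outside a compact set. 2. $X$ admits a smooth strictly plurisubharmonic exhaustion $\phi$ such that $(X,\omega_\phi,\theta_\phi)$ is a Liouville manifold. 3. If $X$ admits a smooth strictly plurisubharmonic exhaustion with compact critical set, then it admits a smooth strictly plurisubharmonic exhaustion $\phi$ with compact critical set such that $(X,\omega_\phi,\theta_\phi)$ is a Liouville manifold of finite type. -/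

import Mathlib

open Set Filter Topology
open scoped Manifold ContDiff

noncomputable section

namespace SteinLiouville

/-! ## Exact symplectic manifolds and Liouville manifolds

`M` is a real manifold modelled on the finite-dimensional real normed space `E`.  The tangent space
of `M` at `x` is identified by Mathlib with `E` through the preferred chart at `x`. -/

section Real

variable {E : Type*} [NormedAddCommGroup E] [NormedSpace ℝ E]
  {M : Type*} [TopologicalSpace M] [ChartedSpace E M]

/-- A differential `1`-form on `M` (no regularity). -/
abbrev OneForm (E : Type*) [NormedAddCommGroup E] [NormedSpace ℝ E]
    (M : Type*) [TopologicalSpace M] [ChartedSpace E M] : Type _ :=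
  (x : M) → TangentSpace 𝓘(ℝ, E) x →L[ℝ] ℝ

/-- A differential `2`-form on `M` (no regularity). -/
abbrev TwoForm (E : Type*) [NormedAddCommGroup E] [NormedSpace ℝ E]
    (M : Type*) [TopologicalSpace M] [ChartedSpace E M] : Type _ :=
  (x : M) → TangentSpace 𝓘(ℝ, E) x [⋀^Fin 2]→L[ℝ] ℝ

/-- A vector field on `M` (no regularity). -/
abbrev VField (E : Type*) [NormedAddCommGroup E] [NormedSpace ℝ E]
    (M : Type*) [TopologicalSpace M] [ChartedSpace E M] : Type _ :=
  (x : M) → TangentSpace 𝓘(ℝ, E) x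

/-- The expression of the `1`-form `θ` in the chart at `x₀`: the pullback of `θ` by the inverse of
the chart (meaningful on the target of the chart). -/
def OneForm.inChart (θ : OneForm E M) (x₀ : M) (y : E) : E →L[ℝ] ℝ :=
  (θ ((extChartAt 𝓘(ℝ, E) x₀).symm y)).comp
    (mfderiv 𝓘(ℝ, E) 𝓘(ℝ, E) (extChartAt 𝓘(ℝ, E) x₀).symm y)

/-- A `1`-form is smooth if its expressions in the charts are. -/
def OneForm.IsSmooth (θ : OneForm E M) : Prop :=
  ∀ x₀ : M, ContDiffOn ℝ ∞ (OneForm.inChart θ x₀) (extChartAt 𝓘(ℝ, E) x₀).target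

/-- The exterior derivative `dθ` of a `1`-form, computed at `x` in the chart at `x`, through which
the tangent space at `x` is identified with `E`. -/
def OneForm.d (θ : OneForm E M) : TwoForm E M := fun x =>
  (extDeriv (fun y : E => ContinuousAlternatingMap.ofSubsingleton ℝ E ℝ (0 : Fin 1)
    (OneForm.inChart θ x y)) (extChartAt 𝓘(ℝ, E) x x) : E [⋀^Fin 2]→L[ℝ] ℝ)

/-- `η` is nondegenerate at every point. -/
def TwoForm.Nondegenerate (η : TwoForm E M) : Prop :=
  ∀ (x : M) (v : TangentSpace 𝓘(ℝ, E) x),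
    (∀ w : TangentSpace 𝓘(ℝ, E) x, η x ![v, w] = 0) → v = 0

/-- `dθ` is an (exact) symplectic form with primitive `θ`. -/
structure IsExactSymplectic (θ : OneForm E M) : Prop where
  smooth : OneForm.IsSmooth θ
  nondegenerate : TwoForm.Nondegenerate (OneForm.d θ)

/-- `Z` is the Liouville vector field of `θ`: with `ω = dθ`, one has `ω(Z, ·) = θ`.
It is unique when `ω` is nondegenerate. -/
def IsLiouvilleField (θ : OneForm E M) (Z : VField E M) : Prop :=
  ∀ (x : M) (w : TangentSpace 𝓘(ℝ, E) x), OneForm.d θ x ![Z x, w] = θ x w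

/-- The flow of `Z` exists for all time. -/
def VField.IsComplete (Z : VField E M) : Prop :=
  ∀ x : M, ∃ γ : ℝ → M, γ 0 = x ∧ IsMIntegralCurve (I := 𝓘(ℝ, E)) γ Z

/-- A smooth function which is bounded below and proper. -/
structure IsExhausting (E : Type*) [NormedAddCommGroup E] [NormedSpace ℝ E]
    {M : Type*} [TopologicalSpace M] [ChartedSpace E M] (h : M → ℝ) : Prop where
  smooth : ContMDiff 𝓘(ℝ, E) 𝓘(ℝ, ℝ) ∞ h
  bddBelow : BddBelow (range h)
  proper : IsProperMap h

/-- The function `dh(Z)`. -/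
def derivAlong (h : M → ℝ) (Z : VField E M) (x : M) : ℝ :=
  mfderiv 𝓘(ℝ, E) 𝓘(ℝ, ℝ) h x (Z x)

/-- There are levels `c k → +∞` such that `dh(Z) > 0` along `h⁻¹(c k)`. -/
def HasPositiveLevels (h : M → ℝ) (Z : VField E M) : Prop :=
  ∃ c : ℕ → ℝ, Tendsto c atTop atTop ∧ ∀ (k : ℕ) (x : M), h x = c k → 0 < derivAlong h Z x

/-- `dh(Z) > 0` outside a compact set. -/
def IsPositiveOutsideCompact (h : M → ℝ) (Z : VField E M) : Prop :=
  ∃ C : Set M, IsCompact C ∧ ∀ x : M, x ∉ C → 0 < derivAlong h Z x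

/-- `(M, dθ, θ)` is a Liouville manifold with Liouville vector field `Z`, as witnessed by the
exhausting function `h`. -/
structure IsLiouvilleWith (θ : OneForm E M) (Z : VField E M) (h : M → ℝ) : Prop where
  exactSymplectic : IsExactSymplectic θ
  liouvilleField : IsLiouvilleField θ Z
  complete : VField.IsComplete Z
  exhausting : IsExhausting E h
  positiveLevels : HasPositiveLevels h Z

/-- `(M, dθ, θ)` is a Liouville manifold. -/
def IsLiouvilleManifold (θ : OneForm E M) : Prop :=
  ∃ (Z : VField E M) (h : M → ℝ), IsLiouvilleWith θ Z h

/-- `(M, dθ, θ)` is a Liouville manifold of finite type. -/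
def IsFiniteTypeLiouvilleManifold (θ : OneForm E M) : Prop :=
  ∃ (Z : VField E M) (h : M → ℝ), IsLiouvilleWith θ Z h ∧ IsPositiveOutsideCompact h Z

end Real

/-! ## Stein manifolds and strictly plurisubharmonic functions

`X` is a complex manifold modelled on the finite-dimensional complex normed space `E`, of complex
dimension `Module.finrank ℂ E`.  It is also a real manifold, with the same charts. -/

section Complex

variable {E : Type*} [NormedAddCommGroup E] [NormedSpace ℂ E]
  {X : Type*} [TopologicalSpace X] [ChartedSpace E X]

/-- The algebra `A(X)` of holomorphic (that is, complex analytic) functions on `X`. -/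
def holomorphicFunctions (E : Type*) [NormedAddCommGroup E] [NormedSpace ℂ E]
    (X : Type*) [TopologicalSpace X] [ChartedSpace E X] : Set (X → ℂ) :=
  {f | ContMDiff 𝓘(ℂ, E) 𝓘(ℂ, ℂ) ω f}

/-- The holomorphically convex hull of `K`. -/
def holomorphicHull (E : Type*) [NormedAddCommGroup E] [NormedSpace ℂ E]
    {X : Type*} [TopologicalSpace X] [ChartedSpace E X] (K : Set X) : Set X :=
  {z | ∀ f ∈ holomorphicFunctions E X, ‖f z‖ ≤ sSup ((fun w => ‖f w‖) '' K)}

/-- The three axioms of a Stein manifold: holomorphic convexity, separation of points, and local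
coordinates given by global holomorphic functions. -/
structure IsStein (E : Type*) [NormedAddCommGroup E] [NormedSpace ℂ E]
    (X : Type*) [TopologicalSpace X] [ChartedSpace E X] : Prop where
  convexity : ∀ K : Set X, IsCompact K → IsCompact (holomorphicHull E K)
  separation : ∀ z₁ z₂ : X, z₁ ≠ z₂ → ∃ f ∈ holomorphicFunctions E X, f z₁ ≠ f z₂
  localCoordinates : ∀ z : X, ∃ f : Fin (Module.finrank ℂ E) → X → ℂ,
    (∀ j, f j ∈ holomorphicFunctions E X) ∧
      IsLocalDiffeomorphAt 𝓘(ℂ, E) 𝓘(ℂ, Fin (Module.finrank ℂ E) → ℂ) ω (fun x j => f j x) z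

/-- The Wirtinger derivative of `g` in the direction `a`; it is `∂g/∂zⱼ` if `a` is the `j`-th vector
of the basis with complex coordinates `z₁, …, zₙ`. -/
def wirtinger (a : E) (g : E → ℂ) (y : E) : ℂ :=
  (1 / 2 : ℂ) * (fderiv ℝ g y a - Complex.I * fderiv ℝ g y (Complex.I • a))

/-- The conjugate Wirtinger derivative of `g` in the direction `a`; it is `∂g/∂z̄ⱼ` if `a` is the
`j`-th vector of the basis with complex coordinates `z₁, …, zₙ`. -/
def wirtingerBar (a : E) (g : E → ℂ) (y : E) : ℂ :=
  (1 / 2 : ℂ) * (fderiv ℝ g y a + Complex.I * fderiv ℝ g y (Complex.I • a))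

/-- The Levi form `∑ⱼₖ ∂²u/∂zⱼ∂z̄ₖ(y) wⱼ w̄ₖ` of `u`, in the linear coordinates of `E` given by a
basis (the value does not depend on the basis). -/
def leviForm [FiniteDimensional ℂ E] (u : E → ℝ) (y w : E) : ℂ :=
  let b := Module.finBasis ℂ E
  ∑ j, ∑ k, wirtinger (b j) (wirtingerBar (b k) (fun p => (u p : ℂ))) y
    * b.repr w j * (starRingEnd ℂ) (b.repr w k)

/-- A smooth strictly plurisubharmonic function: at each point its Levi form, in holomorphic
coordinates around the point, is positive definite (a condition that does not depend on the
holomorphic coordinates; the Levi form of a smooth real function is real-valued). -/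
structure IsSmoothStrictlyPSH (E : Type*) [NormedAddCommGroup E] [NormedSpace ℂ E]
    [FiniteDimensional ℂ E] {X : Type*} [TopologicalSpace X] [ChartedSpace E X]
    (φ : X → ℝ) : Prop where
  smooth : ContMDiff 𝓘(ℝ, E) 𝓘(ℝ, ℝ) ∞ φ
  pos : ∀ (x : X) (w : E), w ≠ 0 →
    0 < (leviForm (φ ∘ (extChartAt 𝓘(ℝ, E) x).symm) (extChartAt 𝓘(ℝ, E) x x) w).re

/-- A smooth strictly plurisubharmonic exhaustion: the sets `{φ < c}` are relatively compact. -/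
structure IsStrictlyPSHExhaustion (E : Type*) [NormedAddCommGroup E] [NormedSpace ℂ E]
    [FiniteDimensional ℂ E] {X : Type*} [TopologicalSpace X] [ChartedSpace E X]
    (φ : X → ℝ) : Prop where
  strictlyPSH : IsSmoothStrictlyPSH E φ
  relCompact : ∀ c : ℝ, IsCompact (closure {z : X | φ z < c})

/-- The complex structure `J` on the tangent spaces: multiplication by `i`.  It does not depend on
the holomorphic chart used to identify the tangent space with `E`. -/
def complexStructure (x : X) : TangentSpace 𝓘(ℝ, E) x →L[ℝ] TangentSpace 𝓘(ℝ, E) x :=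
  (ContinuousLinearMap.restrictScalars ℝ (Complex.I • ContinuousLinearMap.id ℂ E) : E →L[ℝ] E)

/-- The `1`-form `d^c φ`, given by `d^c φ (v) = dφ (J v)`. -/
def dc (E : Type*) [NormedAddCommGroup E] [NormedSpace ℂ E]
    {X : Type*} [TopologicalSpace X] [ChartedSpace E X] (φ : X → ℝ) : OneForm E X := fun x =>
  (mfderiv 𝓘(ℝ, E) 𝓘(ℝ, ℝ) φ x).comp (complexStructure x)

/-- The `1`-form `θ = -d^c φ`, whose exterior derivative is `ω = -d d^c φ`. -/
def liouvilleForm (E : Type*) [NormedAddCommGroup E] [NormedSpace ℂ E]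
    {X : Type*} [TopologicalSpace X] [ChartedSpace E X] (φ : X → ℝ) : OneForm E X := fun x =>
  -(dc E φ x)

/-- The critical set of `φ`. -/
def criticalSet (E : Type*) [NormedAddCommGroup E] [NormedSpace ℂ E]
    {X : Type*} [TopologicalSpace X] [ChartedSpace E X] (φ : X → ℝ) : Set X :=
  {x | mfderiv 𝓘(ℝ, E) 𝓘(ℝ, ℝ) φ x = 0}

end Complex

end SteinLiouville

end

/-!
Let `φ` be a smooth strictly plurisubharmonic function, `θ = -d^c φ` and `ω = dθ`. In a holomorphic
chart, `ω` is the form `ddcForm` of the expression of `φ`, and `ω(v, iv)` is four times the Levi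
form at `v` (`ddcForm_mulI`); so `ω` is nondegenerate, and this is independent of the chart because
the transition maps are holomorphic (`ddcForm_comp`). The Liouville field `Z` satisfies
`dφ(Z) = θ(iZ) = ω(Z, iZ)`, which is positive wherever `dφ ≠ 0` (`derivAlong_pos`). The critical
values of `φ` form a null set (`volume_image_criticalSet`), by the case of Sard's theorem for smooth
real-valued functions (`volume_image_critical_eq_zero`), so there are arbitrarily high levels
without critical points (`hasPositiveLevels_of_isLiouvilleField`).

Completeness is obtained by passing from an exhaustion `φ` to `ψ = e^φ`, which has the same critical
set. Four times the Levi form of `ψ` at `v` is at least `dψ(v)² / ψ`, and taking the Liouville field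
`Z` of `ψ` for `v` gives `0 ≤ dψ(Z) ≤ ψ` (`abs_derivAlong_exp_le`). So `ψ` changes at most
exponentially along a flow line and stays bounded in bounded time; since the
sublevel sets of `ψ` are compact, the flow is complete (`isComplete_of_abs_derivAlong_le`).

A strictly plurisubharmonic exhaustion of a Stein manifold is built as follows. If `z` is not in the
hull of the compact set `K`, there are a holomorphic `f` and a number `a` with `|f|² < a` on `K` and
`|f z|² > a`. With coordinates `g j` at `z` given by global holomorphic functions, a small `ε > 0`
and a convex function `χ` vanishing on the negative half-line, `χ(|f|² + ε ∑ |g j|² - a)` is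
plurisubharmonic and nonnegative, vanishes on `K`, and is positive and strictly plurisubharmonic
near `z` (`IsStein.exists_isPSHBump_nhds`). As the hulls of compact sets are compact, large
multiples of finite sums of such functions add up to a locally finite series whose sum is the
required exhaustion (`IsStein.exists_isStrictlyPSHExhaustion`).
-/

noncomputable section

namespace SteinLiouville

/-! ### Sard's theorem for smooth real functions -/

section Sard

open MeasureTheory

/-- If the derivatives of orders `1, …, n` of `f` vanish at `y`, then `f z - f y` is of order
`n + 1` in `z - y`, uniformly in `y`. -/
theorem norm_sub_le_of_iteratedFDeriv_eq_zero {E F : Type*} [NormedAddCommGroup E]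
    [NormedSpace ℝ E] [NormedAddCommGroup F] [NormedSpace ℝ F] {f : E → F} {n : ℕ} {s : Set E}
    {M : ℝ} (hs : Convex ℝ s) (hf : ∀ x ∈ s, ContDiffAt ℝ (n + 1 : ℕ) f x)
    (hM : ∀ x ∈ s, ‖iteratedFDeriv ℝ (n + 1) f x‖ ≤ M) {y z : E} (hy : y ∈ s) (hz : z ∈ s)
    (h0 : ∀ j, 1 ≤ j → j ≤ n → iteratedFDeriv ℝ j f y = 0) :
    ‖f z - f y‖ ≤ M * ‖z - y‖ ^ (n + 1) := by
  have hM0 : 0 ≤ M := (norm_nonneg _).trans (hM y hy)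
  -- the estimate propagates downwards, from the derivative of order `n + 1` to that of order `1`
  have key : ∀ i ≤ n, ∀ z ∈ s, ‖iteratedFDeriv ℝ (n + 1 - i) f z‖ ≤ M * ‖z - y‖ ^ i := by
    intro i
    induction i with
    | zero => intro _ z hz; simpa using hM z hz
    | succ i ih =>
      intro hi z hz
      have e : n + 1 - (i + 1) + 1 = n + 1 - i := by omega
      have hseg : segment ℝ y z ⊆ s := hs.segment_subset hy hz
      have := Convex.norm_image_sub_le_of_norm_fderiv_le (𝕜 := ℝ)
        (f := iteratedFDeriv ℝ (n + 1 - (i + 1)) f) (s := segment ℝ y z) (C := M * ‖z - y‖ ^ i)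
        (fun x hx => (hf x (hseg hx)).differentiableAt_iteratedFDeriv
          (by exact_mod_cast (by omega : n + 1 - (i + 1) < n + 1)))
        (fun x hx => by
          rw [norm_fderiv_iteratedFDeriv, e]
          refine (ih (by omega) x (hseg hx)).trans ?_
          gcongr
          exact norm_sub_le_of_mem_segment hx)
        (convex_segment y z) (left_mem_segment ℝ y z) (right_mem_segment ℝ y z)
      rw [h0 _ (by omega) (by omega), sub_zero] at this
      rw [pow_succ, ← mul_assoc]
      exact this
  have hseg : segment ℝ y z ⊆ s := hs.segment_subset hy hz
  have := Convex.norm_image_sub_le_of_norm_fderiv_le (𝕜 := ℝ)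
    (f := f) (s := segment ℝ y z) (C := M * ‖z - y‖ ^ n)
    (fun x hx => (hf x (hseg hx)).differentiableAt (by simp))
    (fun x hx => by
      rw [← norm_iteratedFDeriv_one]
      have := key n le_rfl x (hseg hx)
      rw [Nat.add_sub_cancel_left] at this
      refine this.trans ?_
      gcongr
      exact norm_sub_le_of_mem_segment hx)
    (convex_segment y z) (left_mem_segment ℝ y z) (right_mem_segment ℝ y z)
  rw [pow_succ, ← mul_assoc]
  exact this

/-- At points where all derivatives of orders `1, …, dim E` vanish, `f` is locally Hölder of
exponent `dim E + 1`, so the image of the set of these points has Hausdorff dimension less than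
`1`. -/
theorem volume_image_eq_zero_of_flat {E : Type*} [NormedAddCommGroup E] [NormedSpace ℝ E]
    [FiniteDimensional ℝ E] {f : E → ℝ} {s : Set E} (hf : ∀ x ∈ s, ContDiffAt ℝ ∞ f x)
    (h0 : ∀ x ∈ s, ∀ j, 1 ≤ j → j ≤ Module.finrank ℝ E → iteratedFDeriv ℝ j f x = 0) :
    volume (f '' s) = 0 := by
  set n := Module.finrank ℝ E with hn
  have hdim : dimH (f '' s) ≤ dimH s / ((n + 1 : ℕ) : NNReal) := by
    refine dimH_image_le_of_locally_holder_on (by positivity) fun x hx => ?_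
    have h1 : ContDiffAt ℝ (n + 1 : ℕ) f x := (hf x hx).of_le (by exact_mod_cast le_top)
    have hc : ContinuousAt (iteratedFDeriv ℝ (n + 1) f) x :=
      (h1.iteratedFDeriv_right (m := 0) (i := n + 1) (by simp)).continuousAt
    have he : ∀ᶠ y in 𝓝 x, ContDiffAt ℝ (n + 1 : ℕ) f y ∧
        ‖iteratedFDeriv ℝ (n + 1) f y‖ ≤ ‖iteratedFDeriv ℝ (n + 1) f x‖ + 1 :=
      (h1.eventually (by simp)).and
        ((hc.norm.eventually (gt_mem_nhds (lt_add_one _))).mono fun _ h => h.le)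
    obtain ⟨r, hr, hball⟩ := Metric.eventually_nhds_iff_ball.1 he
    refine ⟨‖iteratedFDeriv ℝ (n + 1) f x‖₊ + 1, s ∩ Metric.ball x r,
      inter_mem_nhdsWithin _ (Metric.ball_mem_nhds x hr), fun z hz y hy => ?_⟩
    have := norm_sub_le_of_iteratedFDeriv_eq_zero (convex_ball x r) (fun y hy => (hball y hy).1)
      (fun y hy => (hball y hy).2) hy.2 hz.2 (h0 y hy.1)
    rw [edist_dist, edist_dist, dist_eq_norm, dist_eq_norm, NNReal.coe_natCast,
      ENNReal.rpow_natCast, ← ENNReal.ofReal_pow (norm_nonneg _), ← ENNReal.ofReal_coe_nnreal,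
      ← ENNReal.ofReal_mul (NNReal.coe_nonneg _)]
    exact ENNReal.ofReal_le_ofReal this
  have hlt : dimH (f '' s) < ((1 : NNReal) : ENNReal) := by
    refine hdim.trans_lt ?_
    have h2 : dimH s ≤ n := (dimH_mono (subset_univ s)).trans_eq (Real.dimH_univ_eq_finrank E)
    refine (ENNReal.div_le_div_right h2 _).trans_lt ?_
    refine ENNReal.div_lt_of_lt_mul ?_
    simp only [ENNReal.coe_one, one_mul]
    exact_mod_cast Nat.lt_succ_self n
  have := hausdorffMeasure_of_dimH_lt hlt
  rwa [NNReal.coe_one, hausdorffMeasure_real] at this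

theorem volume_image_eq_zero_of_locally {X : Type*} [TopologicalSpace X]
    [SecondCountableTopology X] {f : X → ℝ} {s : Set X}
    (h : ∀ x ∈ s, ∃ u ∈ 𝓝[s] x, volume (f '' u) = 0) : volume (f '' s) = 0 := by
  choose! u hu hu0 using h
  obtain ⟨t, hts, htc, ht⟩ := TopologicalSpace.countable_cover_nhdsWithin hu
  refine measure_mono_null (image_mono ht) ?_
  rw [image_iUnion₂]
  exact (measure_biUnion_null_iff htc).2 fun x hx => hu0 x (hts hx)

/-- If a set of critical points of `f` lies in a regular level set of a function `h`, this level set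
can be locally parametrized by the kernel of `dh`, and the parameters of the critical points are
critical for `f` composed with the parametrization. -/
theorem exists_volume_image_eq_zero_of_regular {E : Type*} [NormedAddCommGroup E]
    [NormedSpace ℝ E] [FiniteDimensional ℝ E] {f h : E → ℝ} {s : Set E} {x : E} (hx : x ∈ s)
    (hf : ∀ y ∈ s, ContDiffAt ℝ ∞ f y) (hf0 : ∀ y ∈ s, fderiv ℝ f y = 0)
    (hh : ∀ y ∈ s, ContDiffAt ℝ ∞ h y) (hh0 : ∀ y ∈ s, h y = 0) (hx0 : fderiv ℝ h x ≠ 0)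
    (ih : ∀ (g : (fderiv ℝ h x).ker → ℝ) (t : Set (fderiv ℝ h x).ker),
      (∀ y ∈ t, ContDiffAt ℝ ∞ g y) → (∀ y ∈ t, fderiv ℝ g y = 0) → volume (g '' t) = 0) :
    ∃ u ∈ 𝓝[s] x, volume (f '' u) = 0 := by
  set K := (fderiv ℝ h x).ker with hK
  obtain ⟨π, hπ⟩ := Submodule.ClosedComplemented.of_finiteDimensional K
  let Φ : E → ℝ × K := fun y => (h y, π y)
  have hΦ : ∀ y ∈ s, ContDiffAt ℝ ∞ Φ y := fun y hy => (hh y hy).prodMk π.contDiff.contDiffAt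
  have hΦx := hΦ x hx
  have hd : fderiv ℝ Φ x = (fderiv ℝ h x).prod π :=
    (((hh x hx).differentiableAt (by simp)).hasFDerivAt.prodMk π.hasFDerivAt).fderiv
  have hinj : Function.Injective (fderiv ℝ Φ x) := by
    rw [injective_iff_map_eq_zero]
    intro v hv
    rw [hd] at hv
    have h1 : fderiv ℝ h x v = 0 := congrArg Prod.fst hv
    have h2 : π v = 0 := congrArg Prod.snd hv
    have h3 := hπ ⟨v, h1⟩
    have h4 : (0 : K) = ⟨v, h1⟩ := h2.symm.trans h3
    simpa using (congrArg Subtype.val h4).symm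
  have hfin : Module.finrank ℝ E = Module.finrank ℝ (ℝ × K) := by
    have := Module.Dual.finrank_ker_add_one_of_ne_zero (f := (fderiv ℝ h x).toLinearMap)
      (fun h => hx0 (ContinuousLinearMap.coe_injective h))
    rw [Module.finrank_prod, Module.finrank_self, ← this, add_comm]
  let A : E ≃L[ℝ] ℝ × K := (LinearMap.linearEquivOfInjective
    (fderiv ℝ Φ x).toLinearMap hinj hfin).toContinuousLinearEquiv
  have hA : (A : E →L[ℝ] ℝ × K) = fderiv ℝ Φ x := by ext v <;> rfl
  have hder : HasFDerivAt Φ (A : E →L[ℝ] ℝ × K) x := by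
    rw [hA]; exact (hΦx.differentiableAt (by simp)).hasFDerivAt
  let e := hΦx.toOpenPartialHomeomorph Φ hder (by simp)
  have hes : x ∈ e.source := hΦx.mem_toOpenPartialHomeomorph_source hder (by simp)
  have hcont : ContinuousAt (fderiv ℝ Φ) x :=
    ((hΦx.fderiv_right (m := 0) (by simp))).continuousAt
  have hN : e.source ∩ fderiv ℝ Φ ⁻¹' range ContinuousLinearEquiv.toContinuousLinearMap ∈ 𝓝 x :=
    inter_mem (e.open_source.mem_nhds hes) (hcont (hA ▸ ContinuousLinearEquiv.nhds A))
  refine ⟨_, inter_mem_nhdsWithin s hN, ?_⟩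
  set u := s ∩ (e.source ∩ fderiv ℝ Φ ⁻¹' range ContinuousLinearEquiv.toContinuousLinearMap)
  let ψ : K → E := fun k => e.symm (0, k)
  have hψ : ∀ y ∈ u, ψ (π y) = y := by
    intro y hy
    have : (0, π y) = e y := by
      change (0, π y) = (h y, π y)
      rw [hh0 y hy.1]
    simp only [ψ]
    rw [this, e.left_inv hy.2.1]
  have himg : f '' u = (f ∘ ψ) '' (π '' u) := by
    rw [← image_comp]
    refine image_congr fun y hy => ?_
    simp [hψ y hy]
  have hψc : ∀ y ∈ u, ContDiffAt ℝ ∞ ψ (π y) := by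
    intro y hy
    have h1 : e y = (0, π y) := by
      change (h y, π y) = (0, π y)
      rw [hh0 y hy.1]
    obtain ⟨B, hB⟩ := hy.2.2
    have h2 : ContDiffAt ℝ ∞ e.symm (0, π y) := by
      rw [← h1]
      refine e.contDiffAt_symm (f₀' := B) (e.map_source hy.2.1) ?_ ?_
      · rw [e.left_inv hy.2.1, hB]
        exact ((hΦ y hy.1).differentiableAt (by simp)).hasFDerivAt
      · rw [e.left_inv hy.2.1]
        exact hΦ y hy.1
    exact h2.comp (π y) (contDiffAt_const.prodMk contDiffAt_id)
  rw [himg]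
  refine ih _ _ ?_ ?_
  · rintro _ ⟨y, hy, rfl⟩
    refine ContDiffAt.comp (π y) ?_ (hψc y hy)
    rw [hψ y hy]
    exact hf y hy.1
  · rintro _ ⟨y, hy, rfl⟩
    rw [fderiv_comp, hψ y hy, hf0 y hy.1, ContinuousLinearMap.zero_comp]
    · rw [hψ y hy]
      exact (hf y hy.1).differentiableAt (by simp)
    · exact (hψc y hy).differentiableAt (by simp)

universe u

/-- **Sard's theorem** for smooth real functions on a finite-dimensional space, by induction on the
dimension. The critical points at which the derivatives of orders up to the dimension vanish are
dealt with by `volume_image_eq_zero_of_flat`; at each other one, some partial derivative vanishes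
and has a nonzero differential, so that the critical points around it are parametrized by a space of
smaller dimension. The critical points are those of an arbitrary set `s`, since smoothness is only
assumed at the points considered. -/
theorem volume_image_critical_eq_zero (d : ℕ) : ∀ {E : Type u} [NormedAddCommGroup E]
    [NormedSpace ℝ E] [FiniteDimensional ℝ E], Module.finrank ℝ E = d → ∀ (f : E → ℝ) (s : Set E),
    (∀ x ∈ s, ContDiffAt ℝ ∞ f x) → (∀ x ∈ s, fderiv ℝ f x = 0) → volume (f '' s) = 0 := by
  induction d with
  | zero =>
    intro E _ _ _ hE f s hf h0
    exact volume_image_eq_zero_of_flat hf fun x _ j h1 h2 => by omega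
  | succ d ih =>
    intro E _ _ _ hE f s hf h0
    let A : Set E := {x ∈ s | ∀ j, 1 ≤ j → j ≤ d + 1 → iteratedFDeriv ℝ j f x = 0}
    let B : ℕ → Set E := fun k => {x ∈ s | iteratedFDeriv ℝ k f x = 0 ∧
      iteratedFDeriv ℝ (k + 1) f x ≠ 0}
    have hcover : s ⊆ A ∪ ⋃ k, B k := by
      intro x hx
      by_cases hA : ∀ j, 1 ≤ j → j ≤ d + 1 → iteratedFDeriv ℝ j f x = 0
      · exact Or.inl ⟨hx, hA⟩
      right
      push Not at hA
      have hex : ∃ j, 1 ≤ j ∧ iteratedFDeriv ℝ j f x ≠ 0 := by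
        obtain ⟨j, h1, _, h2⟩ := hA
        exact ⟨j, h1, h2⟩
      classical
      obtain ⟨hj1, hj2⟩ := Nat.find_spec hex
      set j := Nat.find hex with hj
      have hj3 : j ≠ 1 := by
        intro h
        rw [h] at hj2
        refine hj2 (norm_eq_zero.1 ?_)
        rw [norm_iteratedFDeriv_one, h0 x hx, norm_zero]
      have h4 : iteratedFDeriv ℝ (j - 1) f x = 0 := by
        by_contra h
        exact Nat.find_min hex (show j - 1 < Nat.find hex by omega) ⟨by omega, h⟩
      refine mem_iUnion.2 ⟨j - 1, hx, h4, ?_⟩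
      rwa [Nat.sub_add_cancel hj1]
    refine measure_mono_null (image_mono hcover) ?_
    rw [image_union, image_iUnion]
    refine measure_union_null ?_ (measure_iUnion_null fun k => ?_)
    · exact volume_image_eq_zero_of_flat (fun x hx => hf x hx.1) fun x hx j h1 h2 =>
        hx.2 j h1 (hE ▸ h2)
    refine volume_image_eq_zero_of_locally fun x hx => ?_
    obtain ⟨v, hv⟩ : ∃ v, iteratedFDeriv ℝ (k + 1) f x v ≠ 0 := by
      by_contra! h
      exact hx.2.2 (ContinuousMultilinearMap.ext h)
    let ev := ContinuousMultilinearMap.apply ℝ (fun _ : Fin k => E) ℝ (Fin.tail v)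
    have hsm : ∀ y ∈ B k, ContDiffAt ℝ ∞ (iteratedFDeriv ℝ k f) y := fun y hy =>
      (hf y hy.1).iteratedFDeriv_right (by exact_mod_cast le_top)
    have hder : fderiv ℝ (fun y => iteratedFDeriv ℝ k f y (Fin.tail v)) x
        = ev.comp (fderiv ℝ (iteratedFDeriv ℝ k f) x) :=
      (ev.hasFDerivAt.comp x ((hsm x hx).differentiableAt (by simp)).hasFDerivAt).fderiv
    have hne : fderiv ℝ (fun y => iteratedFDeriv ℝ k f y (Fin.tail v)) x ≠ 0 := by
      intro h
      rw [iteratedFDeriv_succ_apply_left] at hv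
      rw [hder] at h
      exact hv (DFunLike.congr_fun h (v 0))
    refine exists_volume_image_eq_zero_of_regular
      (h := fun y => iteratedFDeriv ℝ k f y (Fin.tail v)) hx (fun y hy => hf y hy.1)
      (fun y hy => h0 y hy.1)
      (fun y hy => ev.contDiff.contDiffAt.comp y (hsm y hy))
      (fun y hy => by simp [hy.2.1]) hne (fun g t => ih ?_ g t)
    have := Module.Dual.finrank_ker_add_one_of_ne_zero
      (f := (fderiv ℝ (fun y => iteratedFDeriv ℝ k f y (Fin.tail v)) x).toLinearMap)
      (fun h => hne (ContinuousLinearMap.coe_injective h))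
    exact Nat.add_right_cancel (this.trans hE)

end Sard

/-! ### Completeness of vector fields -/

section Complete

theorem hasDerivAt_comp_of_isMIntegralCurve {E : Type*} [NormedAddCommGroup E]
    [NormedSpace ℝ E] {M : Type*} [TopologicalSpace M] [ChartedSpace E M] {v : VField E M}
    {h : M → ℝ} {γ : ℝ → M}
    (hh : ContMDiff 𝓘(ℝ, E) 𝓘(ℝ, ℝ) 1 h) (hγ : IsMIntegralCurve (I := 𝓘(ℝ, E)) γ v) (t : ℝ) :
    HasDerivAt (h ∘ γ) (derivAlong h v (γ t)) t := by
  have h1 := ((hh.mdifferentiableAt (x := γ t) (by simp)).hasMFDerivAt).comp t (hγ t)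
  refine hasDerivAt_iff_hasFDerivAt.2 (hasMFDerivAt_iff_hasFDerivAt.1
    (h1.congr_mfderiv (ContinuousLinearMap.ext fun (a : ℝ) => ?_)))
  change mfderiv 𝓘(ℝ, E) 𝓘(ℝ, ℝ) h (γ t) (a • v (γ t)) = a • derivAlong h v (γ t)
  rw [map_smul]
  rfl

variable {E : Type*} [NormedAddCommGroup E] [NormedSpace ℝ E] [CompleteSpace E]
  {M : Type*} [TopologicalSpace M] [ChartedSpace E M] [IsManifold 𝓘(ℝ, E) 1 M]

/-- The integral curves of a `C¹` vector field starting near a given point exist for a common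
time. -/
theorem exists_nhds_forall_isMIntegralCurveOn {v : VField E M} {x₀ : M}
    (hv : ContMDiffAt 𝓘(ℝ, E) 𝓘(ℝ, E).tangent 1
      (fun x => (⟨x, v x⟩ : TangentBundle 𝓘(ℝ, E) M)) x₀) :
    ∃ U ∈ 𝓝 x₀, ∃ ε > 0, ∀ x ∈ U, ∃ γ : ℝ → M, γ 0 = x ∧
      IsMIntegralCurveOn (I := 𝓘(ℝ, E)) γ v (Ioo (-ε) ε) := by
  rw [contMDiffAt_iff] at hv
  obtain ⟨_, hv⟩ := hv
  obtain ⟨ε, hε, a, r, L, K, hr, hpl⟩ := IsPicardLindelof.of_contDiffAt_one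
    (hv.contDiffAt (by simp)).snd
  obtain ⟨α, hα, hαc⟩ :=
    (hpl 0).exists_forall_mem_closedBall_eq_hasDerivWithinAt_continuousOn
  set y₀ := extChartAt 𝓘(ℝ, E) x₀ x₀
  have hy₀ : α (y₀, 0) = y₀ := (hα y₀ (Metric.mem_closedBall_self r.2)).1
  have hnh : Metric.closedBall y₀ r ×ˢ Icc (0 - ε) (0 + ε) ∈ 𝓝 (y₀, (0 : ℝ)) :=
    prod_mem_nhds (Metric.closedBall_mem_nhds _ hr) (Icc_mem_nhds (by linarith) (by linarith))
  have hcont : ContinuousAt α (y₀, 0) := hαc.continuousAt hnh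
  have htgt : α ⁻¹' (extChartAt 𝓘(ℝ, E) x₀).target ∈ 𝓝 (y₀, (0 : ℝ)) := by
    refine hcont ?_
    rw [hy₀]
    exact (isOpen_extChartAt_target x₀).mem_nhds (mem_extChartAt_target x₀)
  obtain ⟨δ, hδ, hsub⟩ := Metric.mem_nhds_iff.1 (inter_mem hnh htgt)
  refine ⟨(extChartAt 𝓘(ℝ, E) x₀).source ∩ extChartAt 𝓘(ℝ, E) x₀ ⁻¹' Metric.ball y₀ δ,
    inter_mem (extChartAt_source_mem_nhds x₀)
      (continuousAt_extChartAt x₀ (Metric.ball_mem_nhds _ hδ)), δ, hδ, fun x hx => ?_⟩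
  set y := extChartAt 𝓘(ℝ, E) x₀ x with hy
  have hmem : ∀ t ∈ Ioo (-δ) δ, (y ∈ Metric.closedBall y₀ r ∧ t ∈ Icc (0 - ε) (0 + ε)) ∧
      α (y, t) ∈ (extChartAt 𝓘(ℝ, E) x₀).target := by
    intro t ht
    have : (y, t) ∈ Metric.ball (y₀, (0 : ℝ)) δ := by
      rw [← ball_prod_same]
      exact ⟨hx.2, by rw [Real.ball_eq_Ioo]; simpa using ht⟩
    exact hsub this
  have hyr : y ∈ Metric.closedBall y₀ r := (hmem 0 ⟨by linarith, hδ⟩).1.1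
  let f : ℝ → E := fun t => α (y, t)
  refine ⟨(extChartAt 𝓘(ℝ, E) x₀).symm ∘ f, ?_, ?_⟩
  · simp only [Function.comp_apply, f]
    rw [(hα y hyr).1]
    exact (extChartAt 𝓘(ℝ, E) x₀).left_inv hx.1
  intro t ht
  have hIcc : Icc (0 - ε) (0 + ε) ∈ 𝓝 t := by
    refine mem_of_superset (isOpen_Ioo.mem_nhds ht) fun s hs => (hmem s hs).1.2
  let xₜ : M := (extChartAt 𝓘(ℝ, E) x₀).symm (f t)
  let w : E := v xₜ
  have h : HasDerivAt f (fderivWithin ℝ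
      (extChartAt 𝓘(ℝ, E) x₀ ∘ (extChartAt 𝓘(ℝ, E) xₜ).symm) (range 𝓘(ℝ, E))
      (extChartAt 𝓘(ℝ, E) xₜ xₜ) w) t :=
    ((hα y hyr).2 t (hmem t ht).1.2).hasDerivAt hIcc
  rw [← tangentCoordChange_def] at h
  have hf3' : f t ∈ (extChartAt 𝓘(ℝ, E) x₀).target := (hmem t ht).2
  have hft1 := mem_preimage.mp <|
    mem_of_mem_of_subset hf3' (extChartAt 𝓘(ℝ, E) x₀).target_subset_preimage_source
  have hft2 := mem_extChartAt_source (I := 𝓘(ℝ, E)) xₜ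
  -- in the chart at `x₀` the curve has velocity `v`, expressed in that chart; the change of
  -- coordinates back to the chart at the current point returns `v` itself
  have hw : tangentCoordChange 𝓘(ℝ, E) x₀ xₜ xₜ (tangentCoordChange 𝓘(ℝ, E) xₜ x₀ xₜ w) = w := by
    rw [tangentCoordChange_comp (x := x₀) ⟨⟨hft2, hft1⟩, hft2⟩, tangentCoordChange_self hft2]
  have hcc : HasFDerivAt (extChartAt 𝓘(ℝ, E) xₜ ∘ (extChartAt 𝓘(ℝ, E) x₀).symm)
      (tangentCoordChange 𝓘(ℝ, E) x₀ xₜ xₜ) (f t) := by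
    apply HasFDerivWithinAt.hasFDerivAt (s := range 𝓘(ℝ, E)) _ (by simp)
    rw [← (extChartAt 𝓘(ℝ, E) x₀).right_inv hf3']
    exact hasFDerivWithinAt_tangentCoordChange ⟨hft1, hft2⟩
  have hd : HasDerivAt ((extChartAt 𝓘(ℝ, E) xₜ ∘ (extChartAt 𝓘(ℝ, E) x₀).symm) ∘ f) w t := by
    rw [← hw]
    exact hcc.comp_hasDerivAt t h
  exact (show HasMFDerivAt 𝓘(ℝ, ℝ) 𝓘(ℝ, E) ((extChartAt 𝓘(ℝ, E) x₀).symm ∘ f) t _ from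
    ⟨(continuousAt_extChartAt_symm'' hf3').comp h.continuousAt,
      (hasDerivAt_iff_hasFDerivAt.1 hd).hasFDerivWithinAt⟩).hasMFDerivWithinAt

/-- A vector field vanishing outside a compact set is complete. -/
theorem isComplete_of_eq_zero_outside_compact [T2Space M] {v : VField E M}
    (hv : ContMDiff 𝓘(ℝ, E) 𝓘(ℝ, E).tangent 1
      (fun x => (⟨x, v x⟩ : TangentBundle 𝓘(ℝ, E) M)))
    {K : Set M} (hK : IsCompact K) (h0 : ∀ x ∉ K, v x = 0) : VField.IsComplete v := by
  have hunif : ∃ ε > 0, ∀ x ∈ K, ∃ γ : ℝ → M, γ 0 = x ∧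
      IsMIntegralCurveOn (I := 𝓘(ℝ, E)) γ v (Ioo (-ε) ε) := by
    refine hK.induction_on (p := fun s => ∃ ε > 0, ∀ x ∈ s, ∃ γ : ℝ → M, γ 0 = x ∧
      IsMIntegralCurveOn (I := 𝓘(ℝ, E)) γ v (Ioo (-ε) ε)) ⟨1, one_pos, by simp⟩ ?_ ?_ ?_
    · rintro s t hst ⟨ε, hε, h⟩
      exact ⟨ε, hε, fun x hx => h x (hst hx)⟩
    · rintro s t ⟨ε, hε, h⟩ ⟨ε', hε', h'⟩
      refine ⟨min ε ε', lt_min hε hε', ?_⟩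
      rintro x (hx | hx)
      · obtain ⟨γ, h1, h2⟩ := h x hx
        exact ⟨γ, h1, h2.mono (Ioo_subset_Ioo (neg_le_neg (min_le_left _ _)) (min_le_left _ _))⟩
      · obtain ⟨γ, h1, h2⟩ := h' x hx
        exact ⟨γ, h1, h2.mono (Ioo_subset_Ioo (neg_le_neg (min_le_right _ _)) (min_le_right _ _))⟩
    · intro x _
      obtain ⟨U, hU, ε, hε, h⟩ := exists_nhds_forall_isMIntegralCurveOn (hv x)
      exact ⟨U, mem_nhdsWithin_of_mem_nhds hU, ε, hε, h⟩
  obtain ⟨ε, hε, h⟩ := hunif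
  refine exists_isMIntegralCurve_of_isMIntegralCurveOn hv hε fun x => ?_
  by_cases hx : x ∈ K
  · exact h x hx
  · exact ⟨fun _ => x, rfl, (isMIntegralCurve_const (h0 x hx)).isMIntegralCurveOn _⟩

/-- A vector field along which a function with compact sublevel sets grows at most exponentially
is complete. The field is cut off outside a large sublevel set, which an integral curve cannot
leave within a given time. -/
theorem isComplete_of_abs_derivAlong_le [T2Space M] {v : VField E M} {h : M → ℝ}
    (hv : ContMDiff 𝓘(ℝ, E) 𝓘(ℝ, E).tangent 1
      (fun x => (⟨x, v x⟩ : TangentBundle 𝓘(ℝ, E) M)))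
    (hh : ContMDiff 𝓘(ℝ, E) 𝓘(ℝ, ℝ) 1 h) (hcpt : ∀ R : ℝ, IsCompact {x | h x ≤ R})
    (hb : ∀ x, |derivAlong h v x| ≤ h x) : VField.IsComplete v := by
  intro x
  rw [exists_isMIntegralCurve_iff_exists_isMIntegralCurveOn_Ioo hv]
  intro a
  set R := Real.exp |a| * h x with hR
  let ρ : M → ℝ := fun y => Real.smoothTransition (R + 1 - h y)
  have hρ : ContMDiff 𝓘(ℝ, E) 𝓘(ℝ, ℝ) 1 ρ :=
    (Real.smoothTransition.contDiff (n := 1)).contMDiff.comp (contMDiff_const.sub hh)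
  have hV := hρ.smul_section hv
  have hcomp : VField.IsComplete (ρ • v : VField E M) := by
    refine isComplete_of_eq_zero_outside_compact hV (hcpt (R + 1)) fun y hy => ?_
    have h1 : R + 1 - h y ≤ 0 := by
      have : R + 1 < h y := not_le.1 hy
      linarith
    change ρ y • v y = 0
    rw [show ρ y = 0 from Real.smoothTransition.zero_of_nonpos h1, zero_smul]
  obtain ⟨γ, hγ0, hγ⟩ := hcomp x
  refine ⟨γ, hγ0, ?_⟩
  have hder := fun t => hasDerivAt_comp_of_isMIntegralCurve hh hγ t
  have hbd : ∀ y, |derivAlong h (ρ • v : VField E M) y| ≤ h y := by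
    intro y
    have h1 : derivAlong h (ρ • v : VField E M) y = ρ y * derivAlong h v y := by
      change mfderiv 𝓘(ℝ, E) 𝓘(ℝ, ℝ) h y (ρ y • v y) = _
      rw [map_smul]
      rfl
    rw [h1, abs_mul, abs_of_nonneg (Real.smoothTransition.nonneg _)]
    exact (mul_le_of_le_one_left (abs_nonneg _) (Real.smoothTransition.le_one _)).trans (hb y)
  -- `exp (-t) * h (γ t)` decreases and `exp t * h (γ t)` increases
  have hanti : Antitone fun t => Real.exp (-t) * h (γ t) := by
    refine antitone_of_hasDerivAt_nonpos (f' := fun t => Real.exp (-t) * -1 * h (γ t) +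
      Real.exp (-t) * derivAlong h (ρ • v : VField E M) (γ t)) (fun t => ?_) fun t => ?_
    · exact ((hasDerivAt_neg t).exp).mul (hder t)
    · have := (abs_le.1 (hbd (γ t))).2
      have := mul_le_mul_of_nonneg_left this (Real.exp_pos (-t)).le
      simp only [Pi.zero_apply]
      linarith
  have hmono : Monotone fun t => Real.exp t * h (γ t) := by
    refine monotone_of_hasDerivAt_nonneg (f' := fun t => Real.exp t * h (γ t) +
      Real.exp t * derivAlong h (ρ • v : VField E M) (γ t)) (fun t => ?_) fun t => ?_
    · exact (Real.hasDerivAt_exp t).mul (hder t)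
    · have := (abs_le.1 (hbd (γ t))).1
      have := mul_le_mul_of_nonneg_left this (Real.exp_pos t).le
      simp only [Pi.zero_apply]
      linarith
  have hle : ∀ t, h (γ t) ≤ Real.exp |t| * h x := by
    intro t
    rcases le_total 0 t with ht | ht
    · have := hanti ht
      simp only [neg_zero, Real.exp_zero, one_mul, hγ0] at this
      rw [abs_of_nonneg ht]
      calc h (γ t) = Real.exp t * (Real.exp (-t) * h (γ t)) := by
            rw [← mul_assoc, ← Real.exp_add, add_neg_cancel, Real.exp_zero, one_mul]
        _ ≤ _ := by gcongr
    · have := hmono ht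
      simp only [Real.exp_zero, one_mul, hγ0] at this
      rw [abs_of_nonpos ht]
      calc h (γ t) = Real.exp (-t) * (Real.exp t * h (γ t)) := by
            rw [← mul_assoc, ← Real.exp_add, neg_add_cancel, Real.exp_zero, one_mul]
        _ ≤ _ := by gcongr
  intro t ht
  have hx0 : 0 ≤ h x := (abs_nonneg _).trans (hb x)
  have h1 : h (γ t) ≤ R := by
    refine (hle t).trans ?_
    have h2 : |t| ≤ |a| := (abs_lt.2 ht).le.trans (le_abs_self a)
    rw [hR]
    gcongr
  have h3 : (ρ • v : VField E M) (γ t) = v (γ t) := by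
    change ρ (γ t) • v (γ t) = v (γ t)
    rw [show ρ (γ t) = 1 from Real.smoothTransition.one_of_one_le (by linarith), one_smul]
  have h4 := (hγ t).hasMFDerivWithinAt (s := Ioo (-a) a)
  rwa [h3] at h4

end Complete

/-! ### The Levi form and the form `-dd^c` in a complex vector space -/

section Calculus

variable {E : Type*} [NormedAddCommGroup E] [NormedSpace ℂ E]

/-- Multiplication by `i` on `E`, as a real linear map. -/
def mulI (E : Type*) [NormedAddCommGroup E] [NormedSpace ℂ E] : E →L[ℝ] E :=
  ContinuousLinearMap.restrictScalars ℝ (Complex.I • ContinuousLinearMap.id ℂ E)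

@[simp] theorem mulI_apply (v : E) : mulI E v = Complex.I • v := rfl

theorem mulI_mulI (v : E) : mulI E (mulI E v) = -v := by
  simp [smul_smul]

/-- The `2`-form `-dd^c u` at `y`: it is `D²u(w, iv) - D²u(v, iw)` on the vectors `v, w`. -/
def ddcForm (u : E → ℝ) (y : E) : E →L[ℝ] E →L[ℝ] ℝ :=
  (fderiv ℝ (fderiv ℝ u) y).flip.comp (mulI E) -
    ((ContinuousLinearMap.compL ℝ E E ℝ).flip (mulI E)).comp (fderiv ℝ (fderiv ℝ u) y)

theorem ddcForm_apply (u : E → ℝ) (y v w : E) : ddcForm u y v w =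
    fderiv ℝ (fderiv ℝ u) y w (mulI E v) - fderiv ℝ (fderiv ℝ u) y v (mulI E w) := rfl

/-- Four times the Levi form of `u`, in terms of the real second derivative of `u`. -/
def realLevi (u : E → ℝ) (y w : E) : ℝ :=
  fderiv ℝ (fderiv ℝ u) y w w + fderiv ℝ (fderiv ℝ u) y (mulI E w) (mulI E w)

theorem ddcForm_mulI (u : E → ℝ) (y w : E) : ddcForm u y w (mulI E w) = realLevi u y w := by
  rw [ddcForm_apply, mulI_mulI, map_neg, realLevi]
  ring

theorem realLevi_congr {u v : E → ℝ} {y : E} (h : u =ᶠ[𝓝 y] v) (w : E) :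
    realLevi u y w = realLevi v y w := by
  simp only [realLevi, h.fderiv.fderiv_eq]

/-- A real bilinear form, made sesquilinear. -/
def sesquilinearPart (B : E →L[ℝ] E →L[ℝ] ℝ) : E →ₗ[ℂ] E →ₛₗ[starRingEnd ℂ] ℂ :=
  LinearMap.mk₂'ₛₗ (RingHom.id ℂ) (starRingEnd ℂ)
    (fun b a => (1 / 4 : ℂ) * (((B b a + B (mulI E b) (mulI E a) : ℝ) : ℂ) +
      Complex.I * ((B b (mulI E a) - B (mulI E b) a : ℝ) : ℂ)))
    (fun b b' a => by simp only [map_add, add_apply]; push_cast; ring)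
    (fun c b a => by
      have h : c • b = c.re • b + c.im • mulI E b := by
        conv_lhs => rw [← Complex.re_add_im c]
        rw [add_smul, mul_smul]
        rfl
      simp only [h, map_add, map_smul, mulI_mulI, add_apply,
        smul_apply, smul_eq_mul, map_neg, neg_apply,
        RingHom.id_apply]
      conv_rhs => rw [← Complex.re_add_im c]
      push_cast
      linear_combination (1 / 4 : ℂ) * c.im * (B b (mulI E a) - B (mulI E b) a) *
        (-Complex.I_sq))
    (fun b a a' => by simp only [map_add]; push_cast; ring)
    (fun c b a => by
      have h : c • a = c.re • a + c.im • mulI E a := by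
        conv_lhs => rw [← Complex.re_add_im c]
        rw [add_smul, mul_smul]
        rfl
      simp only [h, map_add, map_smul, mulI_mulI, smul_eq_mul, map_neg]
      have h2 : (starRingEnd ℂ) c = c.re - c.im * Complex.I := by
        apply Complex.ext <;> simp
      rw [h2]
      push_cast
      linear_combination (1 / 4 : ℂ) * c.im * (B b (mulI E a) - B (mulI E b) a) *
        (Complex.I_sq))

theorem sesquilinearPart_apply (B : E →L[ℝ] E →L[ℝ] ℝ) (b a : E) :
    sesquilinearPart B b a = (1 / 4 : ℂ) * (((B b a + B (mulI E b) (mulI E a) : ℝ) : ℂ) +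
      Complex.I * ((B b (mulI E a) - B (mulI E b) a : ℝ) : ℂ)) := rfl

theorem wirtinger_wirtingerBar {u : E → ℝ} {y : E} (hu : ContDiffAt ℝ 2 u y) (a b : E) :
    wirtinger b (wirtingerBar a (fun p => (u p : ℂ))) y =
      sesquilinearPart (fderiv ℝ (fderiv ℝ u) y) b a := by
  have h1 : ∀ᶠ p in 𝓝 y, wirtingerBar a (fun p => (u p : ℂ)) p =
      (1 / 2 : ℂ) * ((fderiv ℝ u p a : ℂ) + Complex.I * (fderiv ℝ u p (mulI E a) : ℂ)) := by
    filter_upwards [hu.eventually (by simp)] with p hp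
    have h2 : fderiv ℝ (fun p => (u p : ℂ)) p = Complex.ofRealCLM.comp (fderiv ℝ u p) :=
      (Complex.ofRealCLM.hasFDerivAt.comp p (hp.differentiableAt (by simp)).hasFDerivAt).fderiv
    simp [wirtingerBar, h2]
  have hd : HasFDerivAt (fderiv ℝ u) (fderiv ℝ (fderiv ℝ u) y) y :=
    ((hu.fderiv_right (m := 1) (by norm_num)).differentiableAt (by simp)).hasFDerivAt
  have hev : ∀ c : E, HasFDerivAt (fun p => (fderiv ℝ u p c : ℂ))
      (Complex.ofRealCLM.comp ((fderiv ℝ (fderiv ℝ u) y).flip c)) y := fun c =>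
    Complex.ofRealCLM.hasFDerivAt.comp y
      (((ContinuousLinearMap.apply ℝ ℝ c).hasFDerivAt).comp y hd)
  have h3 := (((hev a).add ((hev (mulI E a)).const_mul Complex.I)).const_mul (1 / 2 : ℂ))
  have h4 : fderiv ℝ (wirtingerBar a (fun p => (u p : ℂ))) y = _ :=
    (EventuallyEq.fderiv_eq h1).trans h3.fderiv
  rw [wirtinger, h4, sesquilinearPart_apply]
  simp only [smul_apply, add_apply,
    ContinuousLinearMap.comp_apply, ContinuousLinearMap.flip_apply, Complex.ofRealCLM_apply,
    smul_eq_mul, ← mulI_apply]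
  push_cast
  linear_combination (-1 / 4 : ℂ) * (fderiv ℝ (fderiv ℝ u) y (mulI E b) (mulI E a)) *
    Complex.I_sq

theorem re_leviForm [FiniteDimensional ℂ E] {u : E → ℝ} {y : E} (hu : ContDiffAt ℝ 2 u y)
    (w : E) : (leviForm u y w).re = realLevi u y w / 4 := by
  have h : leviForm u y w = sesquilinearPart (fderiv ℝ (fderiv ℝ u) y) w w := by
    rw [leviForm]
    simp only [wirtinger_wirtingerBar hu]
    conv_rhs => rw [← (Module.finBasis ℂ E).sum_repr w]
    simp only [map_sum, map_smul, LinearMap.sum_apply, LinearMap.smul_apply,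
      LinearMap.map_smulₛₗ, smul_eq_mul]
    rw [Finset.sum_comm]
    refine Finset.sum_congr rfl fun j _ => ?_
    rw [Finset.mul_sum]
    refine Finset.sum_congr rfl fun k _ => ?_
    ring
  rw [h, sesquilinearPart_apply, realLevi, ← Complex.ofReal_one]
  simp
  ring

/-- The chain rule for the second derivative. -/
theorem fderiv_fderiv_comp_apply {E' : Type*} [NormedAddCommGroup E'] [NormedSpace ℝ E']
    {F : Type*} [NormedAddCommGroup F] [NormedSpace ℝ F] {T : F → E'}
    {u : E' → ℝ} {y : F} (hT : ContDiffAt ℝ 2 T y) (hu : ContDiffAt ℝ 2 u (T y)) (a b : F) :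
    fderiv ℝ (fderiv ℝ (u ∘ T)) y a b =
      fderiv ℝ (fderiv ℝ u) (T y) (fderiv ℝ T y a) (fderiv ℝ T y b) +
        fderiv ℝ u (T y) (fderiv ℝ (fderiv ℝ T) y a b) := by
  have h1 : fderiv ℝ (u ∘ T) =ᶠ[𝓝 y] fun p => (fderiv ℝ u (T p)).comp (fderiv ℝ T p) := by
    filter_upwards [hT.eventually (by simp), hT.continuousAt.eventually (hu.eventually (by simp))]
      with p hp hp'
    exact fderiv_comp p (hp'.differentiableAt (by simp)) (hp.differentiableAt (by simp))
  have hd : HasFDerivAt (fderiv ℝ u) (fderiv ℝ (fderiv ℝ u) (T y)) (T y) :=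
    ((hu.fderiv_right (m := 1) (by norm_num)).differentiableAt (by simp)).hasFDerivAt
  have hd' : HasFDerivAt (fderiv ℝ T) (fderiv ℝ (fderiv ℝ T) y) y :=
    ((hT.fderiv_right (m := 1) (by norm_num)).differentiableAt (by simp)).hasFDerivAt
  have h2 := (hd.comp y (hT.differentiableAt (by simp)).hasFDerivAt).clm_comp hd'
  have h3 : fderiv ℝ (fun p => (fderiv ℝ u (T p)).comp (fderiv ℝ T p)) y = _ := h2.fderiv
  rw [h1.fderiv_eq, h3]
  simp [add_comm]

/-- The form `-dd^c u` is invariant under holomorphic maps. -/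
theorem ddcForm_comp {E' : Type*} [NormedAddCommGroup E'] [NormedSpace ℂ E'] {T : E → E'}
    {u : E' → ℝ} {y : E} (hT : ContDiffAt ℂ 2 T y) (hu : ContDiffAt ℝ 2 u (T y)) (v w : E) :
    ddcForm (u ∘ T) y v w = ddcForm u (T y) (fderiv ℝ T y v) (fderiv ℝ T y w) := by
  have hTR : ContDiffAt ℝ 2 T y := hT.restrict_scalars ℝ
  have hlin : ∀ᶠ p in 𝓝 y, ∀ c, fderiv ℝ T p (mulI E c) = mulI E' (fderiv ℝ T p c) := by
    filter_upwards [hT.eventually (by simp)] with p hp c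
    rw [(hp.differentiableAt (by simp)).fderiv_restrictScalars ℝ]
    simp
  have hd : HasFDerivAt (fderiv ℝ T) (fderiv ℝ (fderiv ℝ T) y) y :=
    ((hTR.fderiv_right (m := 1) (by norm_num)).differentiableAt (by simp)).hasFDerivAt
  have hlin2 : ∀ a c, fderiv ℝ (fderiv ℝ T) y a (mulI E c) =
      mulI E' (fderiv ℝ (fderiv ℝ T) y a c) := by
    intro a c
    have e1 : HasFDerivAt (fun p => fderiv ℝ T p (mulI E c)) _ y :=
      ((ContinuousLinearMap.apply ℝ E' (mulI E c)).hasFDerivAt).comp y hd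
    have e2 : HasFDerivAt (fun p => mulI E' (fderiv ℝ T p c)) _ y :=
      ((mulI E').comp (ContinuousLinearMap.apply ℝ E' c)).hasFDerivAt.comp y hd
    have e3 : (fun p => fderiv ℝ T p (mulI E c)) =ᶠ[𝓝 y] fun p => mulI E' (fderiv ℝ T p c) :=
      hlin.mono fun p hp => hp c
    exact DFunLike.congr_fun (e1.unique (e2.congr_of_eventuallyEq e3)) a
  have hsymm : fderiv ℝ (fderiv ℝ T) y w v = fderiv ℝ (fderiv ℝ T) y v w :=
    (hTR.isSymmSndFDerivAt (by simp)).eq w v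
  simp only [ddcForm_apply, fderiv_fderiv_comp_apply hTR hu, hlin2, hlin.self_of_nhds, hsymm]
  ring

theorem realLevi_comp {E' : Type*} [NormedAddCommGroup E'] [NormedSpace ℂ E'] {T : E → E'}
    {u : E' → ℝ} {y : E} (hT : ContDiffAt ℂ 2 T y) (hu : ContDiffAt ℝ 2 u (T y)) (w : E) :
    realLevi (u ∘ T) y w = realLevi u (T y) (fderiv ℝ T y w) := by
  rw [← ddcForm_mulI, ddcForm_comp hT hu, ← ddcForm_mulI]
  congr 1
  rw [(hT.differentiableAt (by simp)).fderiv_restrictScalars ℝ]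
  simp

theorem realLevi_comp_real {χ : ℝ → ℝ} {u : E → ℝ} {y : E} (hχ : ContDiff ℝ 2 χ)
    (hu : ContDiffAt ℝ 2 u y) (w : E) : realLevi (χ ∘ u) y w =
      deriv χ (u y) * realLevi u y w +
        deriv (deriv χ) (u y) * ((fderiv ℝ u y w) ^ 2 + (fderiv ℝ u y (mulI E w)) ^ 2) := by
  have h1 : ∀ t, fderiv ℝ χ t = ContinuousLinearMap.smulRight (1 : ℝ →L[ℝ] ℝ) (deriv χ t) :=
    fun t => by ext; simp
  have hd : DifferentiableAt ℝ (fderiv ℝ χ) (u y) :=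
    (hχ.contDiffAt.fderiv_right (m := 1) (by norm_num)).differentiableAt (by simp)
  have h2 : ∀ a b : ℝ, fderiv ℝ (fderiv ℝ χ) (u y) a b = deriv (deriv χ) (u y) * a * b := by
    intro a b
    have e : HasFDerivAt (fun t => fderiv ℝ χ t 1) _ (u y) :=
      ((ContinuousLinearMap.apply ℝ ℝ (1 : ℝ)).hasFDerivAt).comp (u y) hd.hasFDerivAt
    have e2 : (fun t => fderiv ℝ χ t 1) = deriv χ := by
      ext t; exact fderiv_apply_one_eq_deriv
    rw [e2] at e
    have e3 : fderiv ℝ (fderiv ℝ χ) (u y) 1 1 = deriv (deriv χ) (u y) := e.hasDerivAt.deriv.symm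
    have e4 : fderiv ℝ (fderiv ℝ χ) (u y) a b =
        fderiv ℝ (fderiv ℝ χ) (u y) (a • 1) (b • 1) := by simp
    rw [e4, map_smul, map_smul, smul_apply, e3]
    simp only [smul_eq_mul]
    ring
  simp only [realLevi, fderiv_fderiv_comp_apply hu hχ.contDiffAt, h2, h1]
  simp
  ring

theorem realLevi_add {u v : E → ℝ} {y : E} (hu : ContDiffAt ℝ 2 u y) (hv : ContDiffAt ℝ 2 v y)
    (w : E) : realLevi (fun p => u p + v p) y w = realLevi u y w + realLevi v y w := by
  have h1 : fderiv ℝ (fun p => u p + v p) =ᶠ[𝓝 y] fun p => fderiv ℝ u p + fderiv ℝ v p := by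
    filter_upwards [hu.eventually (by simp), hv.eventually (by simp)] with p hp hp'
    exact fderiv_fun_add (hp.differentiableAt (by simp)) (hp'.differentiableAt (by simp))
  have h2 := fderiv_fun_add
    ((hu.fderiv_right (m := 1) (by norm_num)).differentiableAt (by simp))
    ((hv.fderiv_right (m := 1) (by norm_num)).differentiableAt (by simp))
  simp only [realLevi, h1.fderiv_eq, h2, add_apply]
  ring

theorem realLevi_const_mul {u : E → ℝ} {y : E} (c : ℝ) (hu : ContDiffAt ℝ 2 u y) (w : E) :
    realLevi (fun p => c * u p) y w = c * realLevi u y w := by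
  have h1 : fderiv ℝ (fun p => c * u p) =ᶠ[𝓝 y] fun p => c • fderiv ℝ u p := by
    filter_upwards [hu.eventually (by simp)] with p hp
    exact fderiv_const_mul (hp.differentiableAt (by simp)) c
  have h2 := fderiv_fun_const_smul
    ((hu.fderiv_right (m := 1) (by norm_num)).differentiableAt (by simp)) c
  simp only [realLevi, h1.fderiv_eq, h2, smul_apply, smul_eq_mul]
  ring

theorem realLevi_const (c : ℝ) (y w : E) : realLevi (fun _ => c) y w = 0 := by
  simp [realLevi]

theorem realLevi_norm_sq (z w : ℂ) : realLevi (fun z : ℂ => ‖z‖ ^ 2) z w = 4 * ‖w‖ ^ 2 := by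
  have h1 : fderiv ℝ (fun z : ℂ => ‖z‖ ^ 2) = fun z => 2 • innerSL ℝ z := by
    ext1 z
    exact (hasStrictFDerivAt_norm_sq z).hasFDerivAt.fderiv
  have h2 : fderiv ℝ (fun z : ℂ => 2 • innerSL ℝ z) z = 2 • innerSL ℝ :=
    ((innerSL ℝ (E := ℂ)).hasFDerivAt.const_smul (2 : ℕ)).fderiv
  have h3 : ∀ v : ℂ, (2 • innerSL ℝ (E := ℂ)) v v = 2 * ‖v‖ ^ 2 := by
    intro v
    rw [← real_inner_self_eq_norm_sq]
    simp
  simp only [realLevi, h1, h2, h3]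
  simp
  ring

/-- The Levi form of `|f|²` for a holomorphic function `f`. -/
theorem realLevi_norm_sq_comp {f : E → ℂ} {y : E} (hf : ContDiffAt ℂ 2 f y) (w : E) :
    realLevi (fun p => ‖f p‖ ^ 2) y w = 4 * ‖fderiv ℝ f y w‖ ^ 2 := by
  rw [← realLevi_norm_sq (f y)]
  exact realLevi_comp (u := fun z : ℂ => ‖z‖ ^ 2) hf (contDiff_norm_sq ℝ).contDiffAt w

end Calculus

/-! ### The Liouville form of a function on a complex manifold, in charts -/

section Charts

variable {E : Type*} [NormedAddCommGroup E] [NormedSpace ℂ E]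
  {X : Type*} [TopologicalSpace X] [ChartedSpace E X]

/-- The expression of a function in the chart at `x`. -/
abbrev chartExpr (E : Type*) [NormedAddCommGroup E] [NormedSpace ℂ E] {X : Type*}
    [TopologicalSpace X] [ChartedSpace E X] {F : Type*} (φ : X → F) (x : X) : E → F :=
  φ ∘ (extChartAt 𝓘(ℝ, E) x).symm

theorem chartExpr_eventuallyEq {F : Type*} {φ : X → F} {x x' p : X}
    (hx : p ∈ (extChartAt 𝓘(ℝ, E) x).source) (hx' : p ∈ (extChartAt 𝓘(ℝ, E) x').source) :
    chartExpr E φ x =ᶠ[𝓝 (extChartAt 𝓘(ℝ, E) x p)]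
      chartExpr E φ x' ∘ (extChartAt 𝓘(ℝ, E) x' ∘ (extChartAt 𝓘(ℝ, E) x).symm) := by
  have h : (extChartAt 𝓘(ℝ, E) x).symm ⁻¹' (extChartAt 𝓘(ℝ, E) x').source ∈
      𝓝 (extChartAt 𝓘(ℝ, E) x p) := by
    refine (continuousAt_extChartAt_symm' hx) ?_
    rw [(extChartAt 𝓘(ℝ, E) x).left_inv hx]
    exact (isOpen_extChartAt_source x').mem_nhds hx'
  filter_upwards [h] with y hy
  simp only [Function.comp_apply]
  rw [(extChartAt 𝓘(ℝ, E) x').left_inv hy]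

theorem mfderiv_eq_fderiv_chartExpr {φ : X → ℝ} (hφ : ContMDiff 𝓘(ℝ, E) 𝓘(ℝ, ℝ) ∞ φ) (x : X) :
    mfderiv 𝓘(ℝ, E) 𝓘(ℝ, ℝ) φ x = fderiv ℝ (chartExpr E φ x) (extChartAt 𝓘(ℝ, E) x x) := by
  refine (hφ.mdifferentiableAt (by simp)).mfderiv.trans ?_
  change fderivWithin ℝ (chartExpr E φ x) (range 𝓘(ℝ, E)) _ = _
  simp

theorem liouvilleForm_apply {φ : X → ℝ} (hφ : ContMDiff 𝓘(ℝ, E) 𝓘(ℝ, ℝ) ∞ φ) (x : X) (w : E) :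
    liouvilleForm E φ x w =
      -fderiv ℝ (chartExpr E φ x) (extChartAt 𝓘(ℝ, E) x x) (mulI E w) := by
  rw [← mfderiv_eq_fderiv_chartExpr hφ]
  rfl

variable [IsManifold 𝓘(ℂ, E) ω X]

/-- A complex manifold is a real manifold, with the same charts. -/
instance isManifold_real : IsManifold 𝓘(ℝ, E) ω X :=
  isManifold_of_contDiffOn 𝓘(ℝ, E) ω X fun e e' he he' => by
    have h := (contDiffGroupoid ω 𝓘(ℂ, E)).compatible he he'
    rw [contDiffGroupoid, mem_groupoid_of_pregroupoid] at h
    exact ContDiffOn.restrict_scalars ℝ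
      (show ContDiffOn ℂ ω (𝓘(ℂ, E) ∘ (e.symm.trans e') ∘ 𝓘(ℂ, E).symm) _ from h.1)

theorem contDiffAt_chartExpr {φ : X → ℝ} (hφ : ContMDiff 𝓘(ℝ, E) 𝓘(ℝ, ℝ) ∞ φ) (x : X) {y : E}
    (hy : y ∈ (extChartAt 𝓘(ℝ, E) x).target) : ContDiffAt ℝ ∞ (chartExpr E φ x) y := by
  have h := (hφ.contMDiffOn (s := univ)).comp
    (contMDiffOn_extChartAt_symm (I := 𝓘(ℝ, E)) (n := ∞) x) (by simp)
  exact (contMDiffOn_iff_contDiffOn.1 h).contDiffAt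
    ((isOpen_extChartAt_target x).mem_nhds hy)

theorem contDiffAt_two_chartExpr {φ : X → ℝ} (hφ : ContMDiff 𝓘(ℝ, E) 𝓘(ℝ, ℝ) ∞ φ) (x : X) :
    ContDiffAt ℝ 2 (chartExpr E φ x) (extChartAt 𝓘(ℝ, E) x x) :=
  (contDiffAt_chartExpr hφ x (mem_extChartAt_target x)).of_le (by norm_cast)

/-- The change of coordinates between two charts is holomorphic. -/
theorem contDiffAt_transition {x x' p : X} (hx : p ∈ (extChartAt 𝓘(ℝ, E) x).source)
    (hx' : p ∈ (extChartAt 𝓘(ℝ, E) x').source) :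
    ContDiffAt ℂ 2 (extChartAt 𝓘(ℝ, E) x' ∘ (extChartAt 𝓘(ℝ, E) x).symm)
      (extChartAt 𝓘(ℝ, E) x p) := by
  have h : ContDiffWithinAt ℂ 2 (extChartAt 𝓘(ℂ, E) x' ∘ (extChartAt 𝓘(ℂ, E) x).symm)
      (range 𝓘(ℂ, E)) (extChartAt 𝓘(ℂ, E) x p) := by
    refine contDiffWithinAt_ext_coord_change x' x ?_
    exact ⟨(extChartAt 𝓘(ℂ, E) x).map_source hx, by
      rw [mem_preimage, PartialEquiv.symm_symm, (extChartAt 𝓘(ℂ, E) x).left_inv hx]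
      exact hx'⟩
  exact h.contDiffAt (by simp)

theorem tangentCoordChange_eq_fderiv (x x' p : X) : tangentCoordChange 𝓘(ℝ, E) x x' p =
    fderiv ℝ (extChartAt 𝓘(ℝ, E) x' ∘ (extChartAt 𝓘(ℝ, E) x).symm)
      (extChartAt 𝓘(ℝ, E) x p) := by
  rw [tangentCoordChange_def]
  simp

theorem tangentCoordChange_mulI {x x' p : X} (hx : p ∈ (extChartAt 𝓘(ℝ, E) x).source)
    (hx' : p ∈ (extChartAt 𝓘(ℝ, E) x').source) (v : E) :
    tangentCoordChange 𝓘(ℝ, E) x x' p (mulI E v) =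
      mulI E (tangentCoordChange 𝓘(ℝ, E) x x' p v) := by
  rw [tangentCoordChange_eq_fderiv,
    ((contDiffAt_transition hx hx').differentiableAt (by simp)).fderiv_restrictScalars ℝ]
  simp

theorem tangentCoordChange_cancel {x x' p : X} (hx : p ∈ (extChartAt 𝓘(ℝ, E) x).source)
    (hx' : p ∈ (extChartAt 𝓘(ℝ, E) x').source) (v : E) :
    tangentCoordChange 𝓘(ℝ, E) x' x p (tangentCoordChange 𝓘(ℝ, E) x x' p v) = v := by
  rw [tangentCoordChange_comp ⟨⟨hx, hx'⟩, hx⟩, tangentCoordChange_self hx]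

theorem fderiv_chartExpr_tangentCoordChange {φ : X → ℝ}
    (hφ : ContMDiff 𝓘(ℝ, E) 𝓘(ℝ, ℝ) ∞ φ) {x x' p : X}
    (hx : p ∈ (extChartAt 𝓘(ℝ, E) x).source) (hx' : p ∈ (extChartAt 𝓘(ℝ, E) x').source) (v : E) :
    fderiv ℝ (chartExpr E φ x) (extChartAt 𝓘(ℝ, E) x p) v =
      fderiv ℝ (chartExpr E φ x') (extChartAt 𝓘(ℝ, E) x' p)
        (tangentCoordChange 𝓘(ℝ, E) x x' p v) := by
  have hp : (extChartAt 𝓘(ℝ, E) x' ∘ (extChartAt 𝓘(ℝ, E) x).symm) (extChartAt 𝓘(ℝ, E) x p) =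
      extChartAt 𝓘(ℝ, E) x' p := by
    simp only [Function.comp_apply]
    rw [(extChartAt 𝓘(ℝ, E) x).left_inv hx]
  rw [(chartExpr_eventuallyEq hx hx').fderiv_eq, fderiv_comp, hp, tangentCoordChange_eq_fderiv]
  · rfl
  · rw [hp]
    exact (contDiffAt_chartExpr hφ x' ((extChartAt 𝓘(ℝ, E) x').map_source hx')).differentiableAt
      (by simp)
  · exact ((contDiffAt_transition hx hx').restrict_scalars ℝ).differentiableAt (by simp)

theorem ddcForm_chartExpr_tangentCoordChange {φ : X → ℝ}
    (hφ : ContMDiff 𝓘(ℝ, E) 𝓘(ℝ, ℝ) ∞ φ) {x x' p : X}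
    (hx : p ∈ (extChartAt 𝓘(ℝ, E) x).source) (hx' : p ∈ (extChartAt 𝓘(ℝ, E) x').source)
    (v w : E) :
    ddcForm (chartExpr E φ x) (extChartAt 𝓘(ℝ, E) x p) v w =
      ddcForm (chartExpr E φ x') (extChartAt 𝓘(ℝ, E) x' p)
        (tangentCoordChange 𝓘(ℝ, E) x x' p v) (tangentCoordChange 𝓘(ℝ, E) x x' p w) := by
  have hp : (extChartAt 𝓘(ℝ, E) x' ∘ (extChartAt 𝓘(ℝ, E) x).symm) (extChartAt 𝓘(ℝ, E) x p) =
      extChartAt 𝓘(ℝ, E) x' p := by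
    simp only [Function.comp_apply]
    rw [(extChartAt 𝓘(ℝ, E) x).left_inv hx]
  have hd : ddcForm (chartExpr E φ x) (extChartAt 𝓘(ℝ, E) x p) =
      ddcForm (chartExpr E φ x' ∘ (extChartAt 𝓘(ℝ, E) x' ∘ (extChartAt 𝓘(ℝ, E) x).symm))
        (extChartAt 𝓘(ℝ, E) x p) := by
    simp only [ddcForm, (chartExpr_eventuallyEq hx hx').fderiv.fderiv_eq]
  have hu : ContDiffAt ℝ 2 (chartExpr E φ x') (extChartAt 𝓘(ℝ, E) x' p) :=
    (contDiffAt_chartExpr hφ x' ((extChartAt 𝓘(ℝ, E) x').map_source hx')).of_le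
      (by norm_cast)
  rw [hd, ddcForm_comp (contDiffAt_transition hx hx') (by rwa [hp]), hp,
    tangentCoordChange_eq_fderiv]

theorem mfderiv_extChartAt_symm_eq {x₀ : X} {y : E} (hy : y ∈ (extChartAt 𝓘(ℝ, E) x₀).target) :
    mfderiv 𝓘(ℝ, E) 𝓘(ℝ, E) (extChartAt 𝓘(ℝ, E) x₀).symm y =
      tangentCoordChange 𝓘(ℝ, E) x₀ ((extChartAt 𝓘(ℝ, E) x₀).symm y)
        ((extChartAt 𝓘(ℝ, E) x₀).symm y) := by
  have h : MDifferentiableAt 𝓘(ℝ, E) 𝓘(ℝ, E) (extChartAt 𝓘(ℝ, E) x₀).symm y :=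
    ((contMDiffOn_extChartAt_symm (I := 𝓘(ℝ, E)) (n := 1) x₀).contMDiffAt
      ((isOpen_extChartAt_target x₀).mem_nhds hy)).mdifferentiableAt (by simp)
  refine h.mfderiv.trans ?_
  rw [tangentCoordChange_eq_fderiv, (extChartAt 𝓘(ℝ, E) x₀).right_inv hy]
  change fderivWithin ℝ (extChartAt 𝓘(ℝ, E) ((extChartAt 𝓘(ℝ, E) x₀).symm y) ∘
    (extChartAt 𝓘(ℝ, E) x₀).symm) (range 𝓘(ℝ, E)) y = _
  simp

/-- In a chart, the Liouville form of `φ` is `-du(i·)`, where `u` is the expression of `φ`. -/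
theorem inChart_liouvilleForm {φ : X → ℝ} (hφ : ContMDiff 𝓘(ℝ, E) 𝓘(ℝ, ℝ) ∞ φ) {x₀ : X} {y : E}
    (hy : y ∈ (extChartAt 𝓘(ℝ, E) x₀).target) :
    OneForm.inChart (liouvilleForm E φ) x₀ y =
      -(fderiv ℝ (chartExpr E φ x₀) y).comp (mulI E) := by
  set p := (extChartAt 𝓘(ℝ, E) x₀).symm y with hp
  have hps : p ∈ (extChartAt 𝓘(ℝ, E) x₀).source := (extChartAt 𝓘(ℝ, E) x₀).map_target hy
  have hpp : p ∈ (extChartAt 𝓘(ℝ, E) p).source := mem_extChartAt_source p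
  have hy' : extChartAt 𝓘(ℝ, E) x₀ p = y := (extChartAt 𝓘(ℝ, E) x₀).right_inv hy
  have key : ∀ w : E, fderiv ℝ (chartExpr E φ p) (extChartAt 𝓘(ℝ, E) p p)
      (mulI E (tangentCoordChange 𝓘(ℝ, E) x₀ p p w)) =
      fderiv ℝ (chartExpr E φ x₀) y (mulI E w) := by
    intro w
    rw [← tangentCoordChange_mulI hps hpp, fderiv_chartExpr_tangentCoordChange hφ hpp hps,
      tangentCoordChange_cancel hps hpp, hy']
  refine ContinuousLinearMap.ext fun w => ?_
  have h1 : mfderiv 𝓘(ℝ, E) 𝓘(ℝ, E) (extChartAt 𝓘(ℝ, E) x₀).symm y w =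
      tangentCoordChange 𝓘(ℝ, E) x₀ p p w :=
    DFunLike.congr_fun (mfderiv_extChartAt_symm_eq hy) w
  exact (congrArg (liouvilleForm E φ p) h1).trans
    ((liouvilleForm_apply hφ p _).trans (congrArg Neg.neg (key w)))

theorem isSmooth_liouvilleForm {φ : X → ℝ} (hφ : ContMDiff 𝓘(ℝ, E) 𝓘(ℝ, ℝ) ∞ φ) :
    OneForm.IsSmooth (liouvilleForm E φ) := by
  intro x₀
  refine ContDiffOn.congr (f := fun y => -(fderiv ℝ (chartExpr E φ x₀) y).comp (mulI E))
    (fun y hy => ContDiffAt.contDiffWithinAt ?_) fun y hy => inChart_liouvilleForm hφ hy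
  exact ((((contDiffAt_chartExpr hφ x₀ hy).fderiv_right (m := ∞) (by simp))).clm_comp
    contDiffAt_const).neg

theorem d_liouvilleForm_apply {φ : X → ℝ} (hφ : ContMDiff 𝓘(ℝ, E) 𝓘(ℝ, ℝ) ∞ φ) (x : X)
    (v w : E) : OneForm.d (liouvilleForm E φ) x ![v, w] =
      ddcForm (chartExpr E φ x) (extChartAt 𝓘(ℝ, E) x x) v w := by
  set y := extChartAt 𝓘(ℝ, E) x x with hy
  have hyt : y ∈ (extChartAt 𝓘(ℝ, E) x).target := mem_extChartAt_target x
  have hd : HasFDerivAt (fderiv ℝ (chartExpr E φ x)) _ y :=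
    ((((contDiffAt_chartExpr hφ x hyt).fderiv_right (m := ∞) (by simp))).differentiableAt
      (by simp)).hasFDerivAt
  have hev : OneForm.inChart (liouvilleForm E φ) x =ᶠ[𝓝 y]
      fun y => -(fderiv ℝ (chartExpr E φ x) y).comp (mulI E) := by
    filter_upwards [(isOpen_extChartAt_target x).mem_nhds hyt] with y hy
    exact inChart_liouvilleForm hφ hy
  have hd2 : HasFDerivAt (OneForm.inChart (liouvilleForm E φ) x)
      (-(((ContinuousLinearMap.compL ℝ E E ℝ).flip (mulI E)).comp
        (fderiv ℝ (fderiv ℝ (chartExpr E φ x)) y))) y :=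
    ((((ContinuousLinearMap.compL ℝ E E ℝ).flip (mulI E)).hasFDerivAt.comp y
      hd).neg).congr_of_eventuallyEq hev
  have hd3 : DifferentiableAt ℝ (fun y : E => ContinuousAlternatingMap.ofSubsingleton ℝ E ℝ
      (0 : Fin 1) (OneForm.inChart (liouvilleForm E φ) x y)) y := by
    exact (ContinuousAlternatingMap.ofSubsingletonLIE (𝕜 := ℝ) (E := E) (F := ℝ)
      (0 : Fin 1)).toContinuousLinearEquiv.differentiableAt.comp y hd2.differentiableAt
  have hev2 : ∀ a b : E, fderiv ℝ (fun y => OneForm.inChart (liouvilleForm E φ) x y a) y b =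
      -fderiv ℝ (fderiv ℝ (chartExpr E φ x)) y b (mulI E a) := by
    intro a b
    have : HasFDerivAt (fun y => OneForm.inChart (liouvilleForm E φ) x y a) _ y :=
      (ContinuousLinearMap.apply ℝ ℝ a).hasFDerivAt.comp y hd2
    rw [this.fderiv]
    rfl
  have hmain := extDeriv_apply hd3 ![v, w]
  refine hmain.trans ?_
  rw [Fin.sum_univ_two]
  simp [hev2, ddcForm_apply, Fin.removeNth]
  ring

end Charts

/-! ### Strictly plurisubharmonic functions and their Liouville fields -/

section Field

variable {E : Type*} [NormedAddCommGroup E] [NormedSpace ℂ E] [FiniteDimensional ℂ E]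
  {X : Type*} [TopologicalSpace X] [ChartedSpace E X] [IsManifold 𝓘(ℂ, E) ω X]

theorem isSmoothStrictlyPSH_iff {φ : X → ℝ} : IsSmoothStrictlyPSH E φ ↔
    ContMDiff 𝓘(ℝ, E) 𝓘(ℝ, ℝ) ∞ φ ∧ ∀ (x : X) (w : E), w ≠ 0 →
      0 < realLevi (chartExpr E φ x) (extChartAt 𝓘(ℝ, E) x x) w := by
  constructor
  · rintro ⟨h1, h2⟩
    refine ⟨h1, fun x w hw => ?_⟩
    have := h2 x w hw
    rw [re_leviForm (contDiffAt_two_chartExpr h1 x)] at this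
    linarith
  · rintro ⟨h1, h2⟩
    refine ⟨h1, fun x w hw => ?_⟩
    rw [re_leviForm (contDiffAt_two_chartExpr h1 x)]
    linarith [h2 x w hw]

theorem isInvertible_of_nondegenerate {V : Type*} [NormedAddCommGroup V] [NormedSpace ℝ V]
    [FiniteDimensional ℝ V] {B : V →L[ℝ] V →L[ℝ] ℝ} (h : ∀ v, (∀ w, B v w = 0) → v = 0) :
    B.IsInvertible := by
  have hinj : Function.Injective B.toLinearMap := by
    rw [injective_iff_map_eq_zero]
    intro v hv
    exact h v fun w => DFunLike.congr_fun hv w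
  have hfin : Module.finrank ℝ V = Module.finrank ℝ (V →L[ℝ] ℝ) := by
    rw [← LinearEquiv.finrank_eq (LinearMap.toContinuousLinearMap (𝕜 := ℝ) (E := V) (F' := ℝ))]
    exact (Subspace.dual_finrank_eq (K := ℝ) (V := V)).symm
  refine ⟨(LinearMap.linearEquivOfInjective B.toLinearMap hinj hfin).toContinuousLinearEquiv, ?_⟩
  ext v w
  rfl

/-- The form `-dd^c φ` of a strictly plurisubharmonic function is positive on the pairs `v, iv`, in
every chart. -/
theorem ddcForm_mulI_pos {φ : X → ℝ} (hφ : IsSmoothStrictlyPSH E φ) {x p : X}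
    (hx : p ∈ (extChartAt 𝓘(ℝ, E) x).source) {v : E} (hv : v ≠ 0) :
    0 < ddcForm (chartExpr E φ x) (extChartAt 𝓘(ℝ, E) x p) v (mulI E v) := by
  have hp := mem_extChartAt_source (I := 𝓘(ℝ, E)) p
  rw [ddcForm_chartExpr_tangentCoordChange hφ.smooth hx hp, tangentCoordChange_mulI hx hp,
    ddcForm_mulI]
  refine (isSmoothStrictlyPSH_iff.1 hφ).2 p _ fun h => hv ?_
  rw [← tangentCoordChange_cancel hx hp v, h, map_zero]

theorem isInvertible_ddcForm {φ : X → ℝ} (hφ : IsSmoothStrictlyPSH E φ) {x p : X}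
    (hx : p ∈ (extChartAt 𝓘(ℝ, E) x).source) :
    (ddcForm (chartExpr E φ x) (extChartAt 𝓘(ℝ, E) x p)).IsInvertible := by
  refine isInvertible_of_nondegenerate fun v hv => ?_
  by_contra h
  exact (ddcForm_mulI_pos hφ hx h).ne' (hv _)

theorem isExactSymplectic_liouvilleForm {φ : X → ℝ} (hφ : IsSmoothStrictlyPSH E φ) :
    IsExactSymplectic (liouvilleForm E φ) := by
  refine ⟨isSmooth_liouvilleForm hφ.smooth, fun x (v : E) hv => ?_⟩
  by_contra h
  refine (ddcForm_mulI_pos hφ (mem_extChartAt_source x) h).ne' ?_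
  rw [← d_liouvilleForm_apply hφ.smooth]
  exact hv _

/-- The Liouville vector field of `-d^c φ`, in the chart at `x` and at the point `y` of `E`. -/
def liouvilleFieldExpr (φ : X → ℝ) (x : X) (y : E) : E :=
  (ddcForm (chartExpr E φ x) y).inverse (-(fderiv ℝ (chartExpr E φ x) y).comp (mulI E))

/-- The Liouville vector field of `-d^c φ`. -/
def liouvilleField (E : Type*) [NormedAddCommGroup E] [NormedSpace ℂ E] {X : Type*}
    [TopologicalSpace X] [ChartedSpace E X] (φ : X → ℝ) : VField E X :=
  fun x => liouvilleFieldExpr (E := E) φ x (extChartAt 𝓘(ℝ, E) x x)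

theorem ddcForm_liouvilleFieldExpr {φ : X → ℝ} (hφ : IsSmoothStrictlyPSH E φ) {x p : X}
    (hx : p ∈ (extChartAt 𝓘(ℝ, E) x).source) :
    ddcForm (chartExpr E φ x) (extChartAt 𝓘(ℝ, E) x p)
      (liouvilleFieldExpr φ x (extChartAt 𝓘(ℝ, E) x p)) =
      -(fderiv ℝ (chartExpr E φ x) (extChartAt 𝓘(ℝ, E) x p)).comp (mulI E) :=
  (isInvertible_ddcForm hφ hx).self_apply_inverse _

theorem isLiouvilleField_liouvilleField {φ : X → ℝ} (hφ : IsSmoothStrictlyPSH E φ) :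
    IsLiouvilleField (liouvilleForm E φ) (liouvilleField E φ) := by
  intro x (w : E)
  refine (d_liouvilleForm_apply hφ.smooth x _ w).trans ?_
  refine Eq.trans ?_ (liouvilleForm_apply hφ.smooth x w).symm
  exact DFunLike.congr_fun (ddcForm_liouvilleFieldExpr hφ (mem_extChartAt_source x)) w

/-- The expressions of the Liouville field in two charts correspond to each other. -/
theorem tangentCoordChange_liouvilleField {φ : X → ℝ} (hφ : IsSmoothStrictlyPSH E φ) {x p : X}
    (hx : p ∈ (extChartAt 𝓘(ℝ, E) x).source) :
    tangentCoordChange 𝓘(ℝ, E) p x p (liouvilleFieldExpr φ p (extChartAt 𝓘(ℝ, E) p p)) =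
      liouvilleFieldExpr φ x (extChartAt 𝓘(ℝ, E) x p) := by
  have hp := mem_extChartAt_source (I := 𝓘(ℝ, E)) p
  refine (isInvertible_ddcForm hφ hx).injective ?_
  rw [ddcForm_liouvilleFieldExpr hφ hx]
  ext w
  have h := DFunLike.congr_fun (ddcForm_liouvilleFieldExpr hφ hp)
    (tangentCoordChange 𝓘(ℝ, E) x p p w)
  rw [ddcForm_chartExpr_tangentCoordChange hφ.smooth hp hx, tangentCoordChange_cancel hx hp] at h
  rw [h]
  simp only [neg_apply, ContinuousLinearMap.comp_apply]
  rw [← tangentCoordChange_mulI hx hp, fderiv_chartExpr_tangentCoordChange hφ.smooth hp hx,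
    tangentCoordChange_cancel hx hp]

theorem contDiffAt_liouvilleFieldExpr {φ : X → ℝ} (hφ : IsSmoothStrictlyPSH E φ) (x : X) :
    ContDiffAt ℝ 1 (liouvilleFieldExpr φ x) (extChartAt 𝓘(ℝ, E) x x) := by
  have hcs : CompleteSpace E := FiniteDimensional.complete ℂ E
  have hu := contDiffAt_chartExpr hφ.smooth x (mem_extChartAt_target x)
  have h1 : ContDiffAt ℝ 2 (fderiv ℝ (chartExpr E φ x)) (extChartAt 𝓘(ℝ, E) x x) :=
    hu.fderiv_right (by norm_cast)
  have h2 : ContDiffAt ℝ 1 (fderiv ℝ (fderiv ℝ (chartExpr E φ x))) (extChartAt 𝓘(ℝ, E) x x) :=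
    h1.fderiv_right (by norm_num)
  have h3 : ContDiffAt ℝ 1 (ddcForm (chartExpr E φ x)) (extChartAt 𝓘(ℝ, E) x x) := by
    refine ContDiffAt.sub (ContDiffAt.clm_comp ?_ contDiffAt_const)
      (contDiffAt_const.clm_comp h2)
    exact (LinearIsometryEquiv.contDiff (F := E →L[ℝ] E →L[ℝ] ℝ)
      (ContinuousLinearMap.flipₗᵢ ℝ E E ℝ)).contDiffAt.comp _ h2
  have h4 := (isInvertible_ddcForm hφ (mem_extChartAt_source x)).contDiffAt_map_inverse
    (n := 1) |>.comp _ h3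
  exact h4.clm_apply ((h1.of_le (by norm_num)).clm_comp contDiffAt_const).neg

theorem contMDiff_liouvilleField {φ : X → ℝ} (hφ : IsSmoothStrictlyPSH E φ) :
    ContMDiff 𝓘(ℝ, E) 𝓘(ℝ, E).tangent 1
      (fun x => (⟨x, liouvilleField E φ x⟩ : TangentBundle 𝓘(ℝ, E) X)) := by
  intro x
  refine (Bundle.contMDiffAt_section x).2 ?_
  have h1 : ContMDiffAt 𝓘(ℝ, E) 𝓘(ℝ, E) 1
      (fun p => liouvilleFieldExpr φ x (extChartAt 𝓘(ℝ, E) x p)) x :=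
    (contDiffAt_liouvilleFieldExpr hφ x).contMDiffAt.comp x contMDiffAt_extChartAt
  refine h1.congr_of_eventuallyEq ?_
  filter_upwards [extChartAt_source_mem_nhds (I := 𝓘(ℝ, E)) x] with p hp
  refine Eq.trans ?_ (tangentCoordChange_liouvilleField hφ hp)
  rw [TangentBundle.trivializationAt_apply]
  rfl

omit [FiniteDimensional ℂ E] in
/-- `dφ(Z) = θ(iZ) = ω(Z, iZ)`, which is four times the Levi form on `Z`. -/
theorem derivAlong_eq_realLevi {φ : X → ℝ} (hφ : ContMDiff 𝓘(ℝ, E) 𝓘(ℝ, ℝ) ∞ φ)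
    {Z : VField E X} (hZ : IsLiouvilleField (liouvilleForm E φ) Z) (x : X) :
    derivAlong φ Z x = realLevi (chartExpr E φ x) (extChartAt 𝓘(ℝ, E) x x) (Z x) := by
  obtain ⟨z, hz⟩ : ∃ z : E, z = Z x := ⟨Z x, rfl⟩
  have h : OneForm.d (liouvilleForm E φ) x ![z, mulI E z] = liouvilleForm E φ x (mulI E z) := by
    have h0 := hZ x (mulI E z)
    rwa [← hz] at h0
  have h1 := (d_liouvilleForm_apply hφ x z (mulI E z)).trans (ddcForm_mulI _ _ z)
  have h2 : liouvilleForm E φ x (mulI E z) =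
      fderiv ℝ (chartExpr E φ x) (extChartAt 𝓘(ℝ, E) x x) z := by
    refine (liouvilleForm_apply hφ x (mulI E z)).trans ?_
    rw [mulI_mulI, map_neg, neg_neg]
  have h3 := h2.symm.trans (h.symm.trans h1)
  rw [← mfderiv_eq_fderiv_chartExpr hφ, hz] at h3
  exact h3

/-- `dφ(Z) > 0` at the points where `φ` is not critical. -/
theorem derivAlong_pos {φ : X → ℝ} (hφ : IsSmoothStrictlyPSH E φ)
    {Z : VField E X} (hZ : IsLiouvilleField (liouvilleForm E φ) Z) {x : X}
    (hx : x ∉ criticalSet E φ) : 0 < derivAlong φ Z x := by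
  rw [derivAlong_eq_realLevi hφ.smooth hZ]
  refine (isSmoothStrictlyPSH_iff.1 hφ).2 x _ fun h0 => hx ?_
  -- if `Z` vanishes, so does the Liouville form, and hence `dφ`
  have h1 : ∀ w : E, mfderiv 𝓘(ℝ, E) 𝓘(ℝ, ℝ) φ x w = 0 := by
    intro w
    have h2 := liouvilleForm_apply hφ.smooth x (mulI E w)
    rw [mulI_mulI, map_neg, neg_neg, ← mfderiv_eq_fderiv_chartExpr hφ.smooth] at h2
    refine h2.symm.trans ((hZ x (mulI E w)).symm.trans ?_)
    refine (d_liouvilleForm_apply hφ.smooth x (Z x) (mulI E w)).trans ?_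
    rw [h0, map_zero, zero_apply]
    rfl
  exact ContinuousLinearMap.ext h1

end Field

/-! ### Regular levels and the exhaustion property -/

section Exhaustion

open MeasureTheory

variable {E : Type*} [NormedAddCommGroup E] [NormedSpace ℂ E] [FiniteDimensional ℂ E]
  {X : Type*} [TopologicalSpace X] [ChartedSpace E X] [IsManifold 𝓘(ℂ, E) ω X]

theorem volume_image_criticalSet [SecondCountableTopology X] {φ : X → ℝ}
    (hφ : ContMDiff 𝓘(ℝ, E) 𝓘(ℝ, ℝ) ∞ φ) : volume (φ '' criticalSet E φ) = 0 := by
  refine volume_image_eq_zero_of_locally fun x _ => ?_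
  refine ⟨criticalSet E φ ∩ (extChartAt 𝓘(ℝ, E) x).source,
    inter_mem_nhdsWithin _ (extChartAt_source_mem_nhds x), ?_⟩
  set u := criticalSet E φ ∩ (extChartAt 𝓘(ℝ, E) x).source
  have himg : φ '' u = chartExpr E φ x '' (extChartAt 𝓘(ℝ, E) x '' u) := by
    rw [← image_comp]
    refine image_congr fun p hp => ?_
    simp only [Function.comp_apply]
    rw [(extChartAt 𝓘(ℝ, E) x).left_inv hp.2]
  rw [himg]
  refine volume_image_critical_eq_zero _ rfl _ _ ?_ ?_
  · rintro _ ⟨p, hp, rfl⟩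
    exact contDiffAt_chartExpr hφ x ((extChartAt 𝓘(ℝ, E) x).map_source hp.2)
  · rintro _ ⟨p, hp, rfl⟩
    ext v
    rw [fderiv_chartExpr_tangentCoordChange hφ hp.2 (mem_extChartAt_source p),
      ← mfderiv_eq_fderiv_chartExpr hφ p]
    exact DFunLike.congr_fun hp.1 _

theorem hasPositiveLevels_of_isLiouvilleField [SecondCountableTopology X] {φ : X → ℝ}
    (hφ : IsSmoothStrictlyPSH E φ) {Z : VField E X}
    (hZ : IsLiouvilleField (liouvilleForm E φ) Z) : HasPositiveLevels φ Z := by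
  have h : ∀ k : ℕ, ∃ c ∈ Ioo (k : ℝ) (k + 1), c ∉ φ '' criticalSet E φ := by
    intro k
    by_contra! hk
    have h1 : volume (Ioo (k : ℝ) (k + 1)) = 0 :=
      measure_mono_null hk (volume_image_criticalSet hφ.smooth)
    rw [Real.volume_Ioo] at h1
    simp at h1
  choose c hc hcr using h
  refine ⟨c, tendsto_atTop_mono (fun k => (hc k).1.le) tendsto_natCast_atTop_atTop,
    fun k x hx => derivAlong_pos hφ hZ fun hcrit => hcr k ⟨x, hcrit, hx⟩⟩

omit [IsManifold 𝓘(ℂ, E) ω X] in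
theorem IsStrictlyPSHExhaustion.isCompact_le {φ : X → ℝ} (hφ : IsStrictlyPSHExhaustion E φ)
    (c : ℝ) : IsCompact {x | φ x ≤ c} :=
  (hφ.relCompact (c + 1)).of_isClosed_subset
    (isClosed_le hφ.strictlyPSH.smooth.continuous continuous_const)
    fun x (hx : φ x ≤ c) => subset_closure (show φ x < c + 1 by linarith)

omit [IsManifold 𝓘(ℂ, E) ω X] in
theorem IsStrictlyPSHExhaustion.isExhausting {φ : X → ℝ} (hφ : IsStrictlyPSHExhaustion E φ) :
    IsExhausting E φ := by
  have hc := hφ.strictlyPSH.smooth.continuous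
  refine ⟨hφ.strictlyPSH.smooth, ?_, ?_⟩
  · obtain ⟨m, hm⟩ := (hφ.isCompact_le 0).bddBelow_image hc.continuousOn
    refine ⟨min m 0, ?_⟩
    rintro _ ⟨x, rfl⟩
    rcases le_total (φ x) 0 with h | h
    · exact (min_le_left _ _).trans (hm ⟨x, h, rfl⟩)
    · exact (min_le_right _ _).trans h
  · refine isProperMap_iff_isCompact_preimage.2 ⟨hc, fun K hK => ?_⟩
    obtain ⟨M, hM⟩ := hK.bddAbove
    exact (hφ.isCompact_le M).of_isClosed_subset (hK.isClosed.preimage hc) fun x hx => hM hx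

end Exhaustion

/-! ### Completeness of the Liouville field of an exponential -/

section Exponential

variable {E : Type*} [NormedAddCommGroup E] [NormedSpace ℂ E] [FiniteDimensional ℂ E]
  {X : Type*} [TopologicalSpace X] [ChartedSpace E X] [IsManifold 𝓘(ℂ, E) ω X]

omit [FiniteDimensional ℂ E] in
theorem realLevi_chartExpr_exp {φ : X → ℝ} (hφ : ContMDiff 𝓘(ℝ, E) 𝓘(ℝ, ℝ) ∞ φ) (x : X) (w : E) :
    realLevi (chartExpr E (fun p => Real.exp (φ p)) x) (extChartAt 𝓘(ℝ, E) x x) w =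
      Real.exp (φ x) * (realLevi (chartExpr E φ x) (extChartAt 𝓘(ℝ, E) x x) w +
        (fderiv ℝ (chartExpr E φ x) (extChartAt 𝓘(ℝ, E) x x) w ^ 2 +
          fderiv ℝ (chartExpr E φ x) (extChartAt 𝓘(ℝ, E) x x) (mulI E w) ^ 2)) := by
  have h := realLevi_comp_real Real.contDiff_exp (contDiffAt_two_chartExpr hφ x) w
  have hx : chartExpr E φ x (extChartAt 𝓘(ℝ, E) x x) = φ x := by simp
  rw [Real.deriv_exp, hx, Real.deriv_exp, ← mul_add] at h
  exact h

omit [FiniteDimensional ℂ E] in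
theorem fderiv_chartExpr_exp {φ : X → ℝ} (hφ : ContMDiff 𝓘(ℝ, E) 𝓘(ℝ, ℝ) ∞ φ) (x : X) :
    fderiv ℝ (chartExpr E (fun p => Real.exp (φ p)) x) (extChartAt 𝓘(ℝ, E) x x) =
      Real.exp (φ x) • fderiv ℝ (chartExpr E φ x) (extChartAt 𝓘(ℝ, E) x x) := by
  have h := (((contDiffAt_two_chartExpr hφ x).differentiableAt
    (by simp)).hasFDerivAt.exp).fderiv
  have hx : chartExpr E φ x (extChartAt 𝓘(ℝ, E) x x) = φ x := by simp
  rw [hx] at h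
  exact h

omit [FiniteDimensional ℂ E] [IsManifold 𝓘(ℂ, E) ω X] in
theorem contMDiff_exp_comp {φ : X → ℝ} (hφ : ContMDiff 𝓘(ℝ, E) 𝓘(ℝ, ℝ) ∞ φ) :
    ContMDiff 𝓘(ℝ, E) 𝓘(ℝ, ℝ) ∞ (fun p => Real.exp (φ p)) :=
  (Real.contDiff_exp (n := ∞)).contMDiff.comp hφ

theorem IsStrictlyPSHExhaustion.exp {φ : X → ℝ} (hφ : IsStrictlyPSHExhaustion E φ) :
    IsStrictlyPSHExhaustion E (fun p => Real.exp (φ p)) := by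
  have hs := hφ.strictlyPSH.smooth
  refine ⟨isSmoothStrictlyPSH_iff.2 ⟨contMDiff_exp_comp hs, fun x w hw => ?_⟩, fun c => ?_⟩
  · rw [realLevi_chartExpr_exp hs]
    have := (isSmoothStrictlyPSH_iff.1 hφ.strictlyPSH).2 x w hw
    positivity
  · refine (hφ.isCompact_le (Real.log c)).of_isClosed_subset isClosed_closure
      (closure_minimal (fun x (hx : Real.exp (φ x) < c) => ?_)
        (isClosed_le hs.continuous continuous_const))
    exact (Real.le_log_iff_exp_le ((Real.exp_pos _).trans hx)).2 hx.le

omit [FiniteDimensional ℂ E] in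
theorem criticalSet_exp {φ : X → ℝ} (hφ : ContMDiff 𝓘(ℝ, E) 𝓘(ℝ, ℝ) ∞ φ) :
    criticalSet E (fun p => Real.exp (φ p)) = criticalSet E φ := by
  ext x
  have h1 : mfderiv 𝓘(ℝ, E) 𝓘(ℝ, ℝ) (fun p => Real.exp (φ p)) x =
      Real.exp (φ x) • mfderiv 𝓘(ℝ, E) 𝓘(ℝ, ℝ) φ x := by
    refine (mfderiv_eq_fderiv_chartExpr (contMDiff_exp_comp hφ) x).trans ?_
    refine (fderiv_chartExpr_exp hφ x).trans ?_
    rw [← mfderiv_eq_fderiv_chartExpr hφ]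
    rfl
  change mfderiv 𝓘(ℝ, E) 𝓘(ℝ, ℝ) (fun p => Real.exp (φ p)) x = 0 ↔
    mfderiv 𝓘(ℝ, E) 𝓘(ℝ, ℝ) φ x = 0
  rw [h1]
  exact smul_eq_zero_iff_right (Real.exp_pos _).ne'

/-- With `ψ = e^φ`, the derivative `t = dψ(Z)` is the value on `Z` of four times the Levi form of
`ψ`, which is at least `t² / ψ`; hence `0 ≤ t ≤ ψ`. -/
theorem abs_derivAlong_exp_le {φ : X → ℝ} (hφ : IsStrictlyPSHExhaustion E φ) {Z : VField E X}
    (hZ : IsLiouvilleField (liouvilleForm E (fun p => Real.exp (φ p))) Z) (x : X) :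
    |derivAlong (fun p => Real.exp (φ p)) Z x| ≤ Real.exp (φ x) := by
  have hs := hφ.strictlyPSH.smooth
  obtain ⟨z, hz⟩ : ∃ z : E, z = Z x := ⟨Z x, rfl⟩
  have h1 : derivAlong (fun p => Real.exp (φ p)) Z x = Real.exp (φ x) *
      (realLevi (chartExpr E φ x) (extChartAt 𝓘(ℝ, E) x x) z +
        (fderiv ℝ (chartExpr E φ x) (extChartAt 𝓘(ℝ, E) x x) z ^ 2 +
          fderiv ℝ (chartExpr E φ x) (extChartAt 𝓘(ℝ, E) x x) (mulI E z) ^ 2)) := by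
    rw [← realLevi_chartExpr_exp hs, hz]
    exact derivAlong_eq_realLevi (contMDiff_exp_comp hs) hZ x
  have h2 : derivAlong (fun p => Real.exp (φ p)) Z x =
      Real.exp (φ x) * fderiv ℝ (chartExpr E φ x) (extChartAt 𝓘(ℝ, E) x x) z := by
    have h3 := congrArg (fun L : E →L[ℝ] ℝ => L z)
      ((mfderiv_eq_fderiv_chartExpr (contMDiff_exp_comp hs) x).trans (fderiv_chartExpr_exp hs x))
    rw [hz] at h3 ⊢
    exact h3
  have h4 : 0 ≤ realLevi (chartExpr E φ x) (extChartAt 𝓘(ℝ, E) x x) z := by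
    rcases eq_or_ne z 0 with h0 | h0
    · simp [h0, realLevi]
    · exact ((isSmoothStrictlyPSH_iff.1 hφ.strictlyPSH).2 x z h0).le
  rw [h2] at h1 ⊢
  have hpos := Real.exp_pos (φ x)
  have h5 := mul_left_cancel₀ hpos.ne' h1
  set d := fderiv ℝ (chartExpr E φ x) (extChartAt 𝓘(ℝ, E) x x) z
  have h6 : 0 ≤ d := by rw [h5]; positivity
  have h7 : d ≤ 1 := by
    by_contra! h
    nlinarith [sq_nonneg (fderiv ℝ (chartExpr E φ x) (extChartAt 𝓘(ℝ, E) x x) (mulI E z))]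
  rw [abs_of_nonneg (by positivity)]
  exact mul_le_of_le_one_right hpos.le h7

theorem IsStrictlyPSHExhaustion.isLiouvilleWith_exp [T2Space X] [SecondCountableTopology X]
    {φ : X → ℝ} (hφ : IsStrictlyPSHExhaustion E φ) :
    IsLiouvilleWith (liouvilleForm E (fun p => Real.exp (φ p)))
      (liouvilleField E (fun p => Real.exp (φ p))) (fun p => Real.exp (φ p)) := by
  have hcs : CompleteSpace E := FiniteDimensional.complete ℂ E
  have hψ := hφ.exp
  have hZ := isLiouvilleField_liouvilleField hψ.strictlyPSH
  refine ⟨isExactSymplectic_liouvilleForm hψ.strictlyPSH, hZ, ?_, hψ.isExhausting,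
    hasPositiveLevels_of_isLiouvilleField hψ.strictlyPSH hZ⟩
  exact isComplete_of_abs_derivAlong_le (contMDiff_liouvilleField hψ.strictlyPSH)
    (hψ.strictlyPSH.smooth.of_le (by norm_cast)) hψ.isCompact_le
    (abs_derivAlong_exp_le hφ hZ)

end Exponential

/-! ### A smooth convex function vanishing on the negative half-line -/

section Cutoff

/-- The primitive of `expNegInvGlue` that vanishes on the negative half-line. -/
def glueIntegral (t : ℝ) : ℝ := ∫ s in (0 : ℝ)..t, expNegInvGlue s

/-- A smooth convex function that vanishes exactly on the nonpositive half-line: the primitive of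
`glueIntegral`. -/
def convexGlue (t : ℝ) : ℝ := ∫ s in (0 : ℝ)..t, glueIntegral s

theorem continuous_expNegInvGlue : Continuous expNegInvGlue :=
  (expNegInvGlue.contDiff (n := 0)).continuous

theorem deriv_glueIntegral : deriv glueIntegral = expNegInvGlue :=
  funext fun t => continuous_expNegInvGlue.deriv_integral _ 0 t

theorem contDiff_glueIntegral : ContDiff ℝ ∞ glueIntegral := by
  refine contDiff_infty_iff_deriv.2 ⟨fun t => ?_, ?_⟩
  · exact (continuous_expNegInvGlue.integral_hasStrictDerivAt 0 t).hasDerivAt.differentiableAt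
  · rw [deriv_glueIntegral]
    exact expNegInvGlue.contDiff

theorem deriv_convexGlue : deriv convexGlue = glueIntegral :=
  funext fun t => contDiff_glueIntegral.continuous.deriv_integral _ 0 t

theorem contDiff_convexGlue : ContDiff ℝ ∞ convexGlue := by
  refine contDiff_infty_iff_deriv.2 ⟨fun t => ?_, ?_⟩
  · exact (contDiff_glueIntegral.continuous.integral_hasStrictDerivAt
      0 t).hasDerivAt.differentiableAt
  · rw [deriv_convexGlue]
    exact contDiff_glueIntegral

theorem integral_eq_zero_of_nonpos {g : ℝ → ℝ} (hg : ∀ t ≤ 0, g t = 0) {t : ℝ} (ht : t ≤ 0) :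
    ∫ s in (0 : ℝ)..t, g s = 0 := by
  refine (intervalIntegral.integral_congr (g := fun _ => 0) fun s hs => ?_).trans (by simp)
  rw [uIcc_of_ge ht] at hs
  exact hg s hs.2

theorem glueIntegral_of_nonpos {t : ℝ} (ht : t ≤ 0) : glueIntegral t = 0 :=
  integral_eq_zero_of_nonpos (fun _ => expNegInvGlue.zero_of_nonpos) ht

theorem glueIntegral_pos {t : ℝ} (ht : 0 < t) : 0 < glueIntegral t :=
  intervalIntegral.intervalIntegral_pos_of_pos_on
    (continuous_expNegInvGlue.intervalIntegrable _ _)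
    (fun _ hs => expNegInvGlue.pos_of_pos hs.1) ht

theorem glueIntegral_nonneg (t : ℝ) : 0 ≤ glueIntegral t := by
  rcases le_or_gt t 0 with h | h
  · exact (glueIntegral_of_nonpos h).ge
  · exact (glueIntegral_pos h).le

theorem convexGlue_of_nonpos {t : ℝ} (ht : t ≤ 0) : convexGlue t = 0 :=
  integral_eq_zero_of_nonpos (fun _ => glueIntegral_of_nonpos) ht

theorem convexGlue_pos {t : ℝ} (ht : 0 < t) : 0 < convexGlue t :=
  intervalIntegral.intervalIntegral_pos_of_pos_on
    (contDiff_glueIntegral.continuous.intervalIntegrable _ _)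
    (fun _ hs => glueIntegral_pos hs.1) ht

theorem convexGlue_nonneg (t : ℝ) : 0 ≤ convexGlue t := by
  rcases le_or_gt t 0 with h | h
  · exact (convexGlue_of_nonpos h).ge
  · exact (convexGlue_pos h).le

end Cutoff

/-! ### The Levi form of a function on a complex manifold -/

section LeviAt

variable {E : Type*} [NormedAddCommGroup E] [NormedSpace ℂ E]
  {X : Type*} [TopologicalSpace X] [ChartedSpace E X]

/-- Four times the Levi form at `x` of a function on a complex manifold, in the chart at `x`. -/
def leviAt (E : Type*) [NormedAddCommGroup E] [NormedSpace ℂ E] {X : Type*}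
    [TopologicalSpace X] [ChartedSpace E X] (u : X → ℝ) (x : X) (w : E) : ℝ :=
  realLevi (chartExpr E u x) (extChartAt 𝓘(ℝ, E) x x) w

theorem leviAt_congr {u v : X → ℝ} {x : X} (h : u =ᶠ[𝓝 x] v) (w : E) :
    leviAt E u x w = leviAt E v x w := by
  refine realLevi_congr ?_ w
  have h1 : Tendsto (extChartAt 𝓘(ℝ, E) x).symm (𝓝 (extChartAt 𝓘(ℝ, E) x x)) (𝓝 x) := by
    simpa using (continuousAt_extChartAt_symm (I := 𝓘(ℝ, E)) x).tendsto
  exact h1.eventually h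

variable [IsManifold 𝓘(ℂ, E) ω X]

theorem leviAt_add {u v : X → ℝ} (hu : ContMDiff 𝓘(ℝ, E) 𝓘(ℝ, ℝ) ∞ u)
    (hv : ContMDiff 𝓘(ℝ, E) 𝓘(ℝ, ℝ) ∞ v) (x : X) (w : E) :
    leviAt E (fun p => u p + v p) x w = leviAt E u x w + leviAt E v x w :=
  realLevi_add (contDiffAt_two_chartExpr hu x) (contDiffAt_two_chartExpr hv x) w

theorem leviAt_const_mul {u : X → ℝ} (c : ℝ) (hu : ContMDiff 𝓘(ℝ, E) 𝓘(ℝ, ℝ) ∞ u)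
    (x : X) (w : E) : leviAt E (fun p => c * u p) x w = c * leviAt E u x w :=
  realLevi_const_mul c (contDiffAt_two_chartExpr hu x) w

theorem leviAt_finsetSum {ι : Type*} {u : ι → X → ℝ} (s : Finset ι)
    (hu : ∀ i, ContMDiff 𝓘(ℝ, E) 𝓘(ℝ, ℝ) ∞ (u i)) (x : X) (w : E) :
    leviAt E (fun p => ∑ i ∈ s, u i p) x w = ∑ i ∈ s, leviAt E (u i) x w := by
  classical
  induction s using Finset.induction_on with
  | empty => exact realLevi_const 0 _ _
  | insert i s hi ih =>
    simp only [Finset.sum_insert hi]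
    rw [leviAt_add (hu i) (contMDiff_finsetSum fun i _ => hu i), ih]

/-- The composition with `convexGlue` multiplies the Levi form by the first derivative, up to a
nonnegative term. -/
theorem le_leviAt_convexGlue {u : X → ℝ} (hu : ContMDiff 𝓘(ℝ, E) 𝓘(ℝ, ℝ) ∞ u) (a : ℝ)
    (x : X) (w : E) : glueIntegral (u x - a) * leviAt E u x w ≤
      leviAt E (fun p => convexGlue (u p - a)) x w := by
  have hχ : ContDiff ℝ 2 (fun t => convexGlue (t - a)) :=
    (contDiff_convexGlue.of_le (by norm_cast)).comp (contDiff_id.sub contDiff_const)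
  have h := realLevi_comp_real hχ (contDiffAt_two_chartExpr hu x) w
  have hx : chartExpr E u x (extChartAt 𝓘(ℝ, E) x x) = u x := by simp
  have h1 : deriv (fun t => convexGlue (t - a)) = fun t => glueIntegral (t - a) := by
    funext t
    rw [deriv_comp_sub_const, deriv_convexGlue]
  have h2 : deriv (fun t => glueIntegral (t - a)) = fun t => expNegInvGlue (t - a) := by
    funext t
    rw [deriv_comp_sub_const, deriv_glueIntegral]
  rw [h1, h2, hx] at h
  have h3 : leviAt E (fun p => convexGlue (u p - a)) x w = _ := h
  rw [h3]
  have := expNegInvGlue.nonneg (u x - a)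
  exact le_add_of_nonneg_right (by positivity)

omit [IsManifold 𝓘(ℂ, E) ω X] in
theorem contDiffAt_chartExpr_of_holomorphic {f : X → ℂ} (hf : f ∈ holomorphicFunctions E X)
    (x : X) : ContDiffAt ℂ ω (chartExpr E f x) (extChartAt 𝓘(ℝ, E) x x) := by
  have h := (contMDiffAt_iff.1 (hf x)).2
  have h' : ContDiffWithinAt ℂ ω (chartExpr E f x) (range 𝓘(ℂ, E)) (extChartAt 𝓘(ℝ, E) x x) := h
  exact h'.contDiffAt (by simp)

omit [IsManifold 𝓘(ℂ, E) ω X] in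
theorem contMDiff_real_of_holomorphic {f : X → ℂ} (hf : f ∈ holomorphicFunctions E X) :
    ContMDiff 𝓘(ℝ, E) 𝓘(ℝ, ℂ) ∞ f := by
  intro x
  refine contMDiffAt_iff.2 ⟨(hf x).continuousAt, ?_⟩
  have h := ((contDiffAt_chartExpr_of_holomorphic hf x).restrict_scalars ℝ).of_le
    (m := ∞) (by simp)
  exact h.contDiffWithinAt

omit [IsManifold 𝓘(ℂ, E) ω X] in
theorem contMDiff_norm_sq_of_holomorphic {f : X → ℂ} (hf : f ∈ holomorphicFunctions E X) :
    ContMDiff 𝓘(ℝ, E) 𝓘(ℝ, ℝ) ∞ (fun p => ‖f p‖ ^ 2) :=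
  (contDiff_norm_sq ℝ (E := ℂ) (n := ∞)).contMDiff.comp (contMDiff_real_of_holomorphic hf)

omit [IsManifold 𝓘(ℂ, E) ω X] in
theorem leviAt_norm_sq {f : X → ℂ} (hf : f ∈ holomorphicFunctions E X) (x : X) (w : E) :
    leviAt E (fun p => ‖f p‖ ^ 2) x w =
      4 * ‖fderiv ℂ (chartExpr E f x) (extChartAt 𝓘(ℝ, E) x x) w‖ ^ 2 := by
  have h := contDiffAt_chartExpr_of_holomorphic hf x
  have h1 := realLevi_norm_sq_comp (h.of_le (m := 2) (by simp)) w
  rw [(h.differentiableAt (by simp)).fderiv_restrictScalars ℝ] at h1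
  exact h1

omit [IsManifold 𝓘(ℂ, E) ω X] in
/-- Near a point where holomorphic functions `g j` are local coordinates, their differentials have
no common zero. -/
theorem eventually_exists_fderiv_ne_zero {n : ℕ} {g : Fin n → X → ℂ}
    (hg : ∀ j, g j ∈ holomorphicFunctions E X) {z : X}
    (hz : IsLocalDiffeomorphAt 𝓘(ℂ, E) 𝓘(ℂ, Fin n → ℂ) ω (fun x j => g j x) z) :
    ∀ᶠ p in 𝓝 z, ∀ w : E, w ≠ 0 →
      ∃ j, fderiv ℂ (chartExpr E (g j) p) (extChartAt 𝓘(ℝ, E) p p) w ≠ 0 := by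
  obtain ⟨Φ, hzΦ, hΦ⟩ := hz
  filter_upwards [Φ.open_source.mem_nhds hzΦ] with p hp w hw
  have hp' : IsLocalDiffeomorphAt 𝓘(ℂ, E) 𝓘(ℂ, Fin n → ℂ) ω (fun x j => g j x) p :=
    ⟨Φ, hp, hΦ⟩
  by_contra! h
  apply hw
  have h1 : mfderiv 𝓘(ℂ, E) 𝓘(ℂ, Fin n → ℂ) (fun x j => g j x) p w = 0 := by
    have hm := (hp'.mdifferentiableAt (by simp)).mfderiv
    have h2 : HasFDerivAt (chartExpr E (fun x j => g j x) p)
        (ContinuousLinearMap.pi fun j =>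
          fderiv ℂ (chartExpr E (g j) p) (extChartAt 𝓘(ℝ, E) p p)) (extChartAt 𝓘(ℝ, E) p p) :=
      hasFDerivAt_pi.2 fun j => ((contDiffAt_chartExpr_of_holomorphic (hg j) p).differentiableAt
        (by simp)).hasFDerivAt
    have h3 : fderivWithin ℂ (writtenInExtChartAt 𝓘(ℂ, E) 𝓘(ℂ, Fin n → ℂ) p (fun x j => g j x))
        (range 𝓘(ℂ, E)) (extChartAt 𝓘(ℂ, E) p p) =
        (ContinuousLinearMap.pi fun j =>
          fderiv ℂ (chartExpr E (g j) p) (extChartAt 𝓘(ℝ, E) p p)) := by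
      rw [ModelWithCorners.range_eq_univ, fderivWithin_univ]
      exact h2.fderiv
    refine (congrArg (fun L : E →L[ℂ] (Fin n → ℂ) => L w) (hm.trans h3)).trans ?_
    funext j
    exact h j
  have h4 := hp'.mfderivToContinuousLinearEquiv_coe (by simp)
  refine (hp'.mfderivToContinuousLinearEquiv (by simp)).injective ?_
  exact ((DFunLike.congr_fun h4 w).trans h1).trans (map_zero _).symm

end LeviAt

/-! ### Strictly plurisubharmonic exhaustions of Stein manifolds -/

section Stein

variable {E : Type*} [NormedAddCommGroup E] [NormedSpace ℂ E]
  {X : Type*} [TopologicalSpace X] [ChartedSpace E X]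

/-- A nonnegative smooth plurisubharmonic function that vanishes on `K`. -/
structure IsPSHBump (E : Type*) [NormedAddCommGroup E] [NormedSpace ℂ E] {X : Type*}
    [TopologicalSpace X] [ChartedSpace E X] (K : Set X) (u : X → ℝ) : Prop where
  smooth : ContMDiff 𝓘(ℝ, E) 𝓘(ℝ, ℝ) ∞ u
  nonneg : ∀ x, 0 ≤ u x
  levi_nonneg : ∀ (x : X) (w : E), 0 ≤ leviAt E u x w
  eq_zero : ∀ x ∈ K, u x = 0

theorem IsPSHBump.zero (K : Set X) : IsPSHBump E K (fun _ => 0) :=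
  ⟨contMDiff_const, fun _ => le_rfl, fun _ _ => (realLevi_const 0 _ _).ge, fun _ _ => rfl⟩

variable [IsManifold 𝓘(ℂ, E) ω X]

theorem IsPSHBump.add {K : Set X} {u v : X → ℝ} (hu : IsPSHBump E K u) (hv : IsPSHBump E K v) :
    IsPSHBump E K (fun p => u p + v p) := by
  refine ⟨hu.smooth.add hv.smooth, fun x => add_nonneg (hu.nonneg x) (hv.nonneg x),
    fun x w => ?_, fun x hx => by rw [hu.eq_zero x hx, hv.eq_zero x hx, add_zero]⟩
  rw [leviAt_add hu.smooth hv.smooth]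
  exact add_nonneg (hu.levi_nonneg x w) (hv.levi_nonneg x w)

theorem IsPSHBump.const_mul {K : Set X} {u : X → ℝ} (hu : IsPSHBump E K u) {c : ℝ} (hc : 0 ≤ c) :
    IsPSHBump E K (fun p => c * u p) := by
  refine ⟨contMDiff_const.mul hu.smooth, fun x => mul_nonneg hc (hu.nonneg x),
    fun x w => ?_, fun x hx => by rw [hu.eq_zero x hx, mul_zero]⟩
  rw [leviAt_const_mul c hu.smooth]
  exact mul_nonneg hc (hu.levi_nonneg x w)

/-- The value at a point is at least `1`, and the Levi form is positive definite there. -/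
def IsLargeStrictAt (E : Type*) [NormedAddCommGroup E] [NormedSpace ℂ E] {X : Type*}
    [TopologicalSpace X] [ChartedSpace E X] (u : X → ℝ) (p : X) : Prop :=
  1 ≤ u p ∧ ∀ w : E, w ≠ 0 → 0 < leviAt E u p w

/-- A point `z` outside the hull of `K` is separated from `K` by some `‖f‖²` with `f` holomorphic.
Adding a small multiple of `∑ ‖g j‖²`, where the `g j` are coordinates at `z`, makes this function
strictly plurisubharmonic near `z`, and the composition with a convex function kills it on `K`. -/
theorem IsStein.exists_isPSHBump_nhds (hX : IsStein E X) {K : Set X} (hK : IsCompact K) {z : X}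
    (hz : z ∉ holomorphicHull E K) :
    ∃ u : X → ℝ, IsPSHBump E K u ∧ ∀ᶠ p in 𝓝 z, IsLargeStrictAt E u p := by
  obtain ⟨f, hf, hfz⟩ : ∃ f ∈ holomorphicFunctions E X,
      sSup ((fun w => ‖f w‖) '' K) < ‖f z‖ := by
    by_contra! h
    exact hz h
  obtain ⟨g, hg, hgz⟩ := hX.localCoordinates z
  have hfc : Continuous f := (contMDiff_real_of_holomorphic hf).continuous
  set m := sSup ((fun w => ‖f w‖) '' K) with hm
  have hmle : ∀ p ∈ K, ‖f p‖ ≤ m := fun p hp =>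
    le_csSup (hK.bddAbove_image hfc.norm.continuousOn) ⟨p, hp, rfl⟩
  have hm0 : 0 ≤ m := Real.sSup_nonneg (by rintro _ ⟨p, -, rfl⟩; exact norm_nonneg _)
  have hgs : ∀ j, ContMDiff 𝓘(ℝ, E) 𝓘(ℝ, ℝ) ∞ (fun p => ‖g j p‖ ^ 2) :=
    fun j => contMDiff_norm_sq_of_holomorphic (hg j)
  have hGs : ContMDiff 𝓘(ℝ, E) 𝓘(ℝ, ℝ) ∞ (fun p => ∑ j, ‖g j p‖ ^ 2) :=
    contMDiff_finsetSum fun j _ => hgs j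
  have hfs := contMDiff_norm_sq_of_holomorphic hf
  obtain ⟨B, hB⟩ := hK.bddAbove_image hGs.continuous.continuousOn
  obtain ⟨a, hma, haz⟩ : ∃ a, m ^ 2 < a ∧ a < ‖f z‖ ^ 2 :=
    exists_between (pow_lt_pow_left₀ hfz hm0 two_ne_zero)
  -- `ε` is so small that adding `ε ∑ ‖g j‖²` to `‖f‖²` does not exceed `a` on `K`
  obtain ⟨ε, hε, hεB⟩ : ∃ ε : ℝ, 0 < ε ∧ ε * B ≤ a - m ^ 2 := by
    refine ⟨(a - m ^ 2) / (|B| + 1), div_pos (by linarith) (by positivity), ?_⟩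
    rw [div_mul_eq_mul_div, div_le_iff₀ (by positivity)]
    exact mul_le_mul_of_nonneg_left (by linarith [le_abs_self B]) (by linarith)
  set S : X → ℝ := fun p => ‖f p‖ ^ 2 + ε * ∑ j, ‖g j p‖ ^ 2 with hS
  have hεGs : ContMDiff 𝓘(ℝ, E) 𝓘(ℝ, ℝ) ∞ (fun p => ε * ∑ j, ‖g j p‖ ^ 2) :=
    contMDiff_const.mul hGs
  have hSs : ContMDiff 𝓘(ℝ, E) 𝓘(ℝ, ℝ) ∞ S := hfs.add hεGs
  have hSlevi : ∀ x w, leviAt E S x w =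
      4 * ‖fderiv ℂ (chartExpr E f x) (extChartAt 𝓘(ℝ, E) x x) w‖ ^ 2 + ε * ∑ j,
        4 * ‖fderiv ℂ (chartExpr E (g j) x) (extChartAt 𝓘(ℝ, E) x x) w‖ ^ 2 := by
    intro x w
    rw [hS, leviAt_add hfs hεGs, leviAt_norm_sq hf,
      leviAt_const_mul ε hGs, leviAt_finsetSum _ hgs]
    simp only [leviAt_norm_sq (hg _)]
  have hSK : ∀ p ∈ K, S p ≤ a := by
    intro p hp
    have h1 : ‖f p‖ ^ 2 ≤ m ^ 2 := pow_le_pow_left₀ (norm_nonneg _) (hmle p hp) 2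
    have h2 : ε * ∑ j, ‖g j p‖ ^ 2 ≤ ε * B := mul_le_mul_of_nonneg_left (hB ⟨p, hp, rfl⟩) hε.le
    simp only [hS]
    linarith
  have hSz : a < S z := by
    have : 0 ≤ ε * ∑ j, ‖g j z‖ ^ 2 := by positivity
    simp only [hS]
    linarith
  have hχz := convexGlue_pos (sub_pos.2 hSz)
  have hus : ContMDiff 𝓘(ℝ, E) 𝓘(ℝ, ℝ) ∞ (fun p => convexGlue (S p - a)) :=
    contDiff_convexGlue.contMDiff.comp (hSs.sub contMDiff_const)
  have hu : IsPSHBump E K (fun p => convexGlue (S p - a)) := by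
    refine ⟨hus, fun x => convexGlue_nonneg _, fun x w => ?_,
      fun x hx => convexGlue_of_nonpos (sub_nonpos.2 (hSK x hx))⟩
    refine le_trans (mul_nonneg (glueIntegral_nonneg _) ?_) (le_leviAt_convexGlue hSs a x w)
    rw [hSlevi]
    positivity
  -- this factor makes the value at `z` equal to `2`, hence greater than `1` nearby
  have hc : 0 < 2 / convexGlue (S z - a) := by positivity
  refine ⟨_, hu.const_mul hc.le, ?_⟩
  have h1 : ∀ᶠ p in 𝓝 z, a < S p := (hSs.continuous.tendsto z).eventually_const_lt hSz
  have h2 : ∀ᶠ p in 𝓝 z, 1 < 2 / convexGlue (S z - a) * convexGlue (S p - a) := by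
    refine ((continuous_const.mul hus.continuous).tendsto z).eventually_const_lt ?_
    rw [Pi.mul_apply, div_mul_cancel₀ _ hχz.ne']
    norm_num
  filter_upwards [h1, h2, eventually_exists_fderiv_ne_zero hg hgz] with p hp1 hp2 hp3
  refine ⟨hp2.le, fun w hw => ?_⟩
  rw [leviAt_const_mul _ hus]
  refine mul_pos hc (lt_of_lt_of_le ?_ (le_leviAt_convexGlue hSs a p w))
  refine mul_pos (glueIntegral_pos (sub_pos.2 hp1)) ?_
  obtain ⟨j, hj⟩ := hp3 w hw
  rw [hSlevi]
  refine add_pos_of_nonneg_of_pos (by positivity) (mul_pos hε ?_)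
  exact Finset.sum_pos' (fun _ _ => by positivity) ⟨j, Finset.mem_univ j, by positivity⟩

theorem IsPSHBump.isLargeStrictAt_add {K : Set X} {u v : X → ℝ} (hu : IsPSHBump E K u)
    (hv : IsPSHBump E K v) {p : X} (hp : IsLargeStrictAt E u p) :
    IsLargeStrictAt E (fun p => u p + v p) p := by
  refine ⟨by linarith [hp.1, hv.nonneg p], fun w hw => ?_⟩
  rw [leviAt_add hu.smooth hv.smooth]
  exact add_pos_of_pos_of_nonneg (hp.2 w hw) (hv.levi_nonneg p w)

/-- Finitely many of the functions given by `IsStein.exists_isPSHBump_nhds` are added up. -/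
theorem IsStein.exists_isPSHBump_of_isCompact (hX : IsStein E X) {K L : Set X} (hK : IsCompact K)
    (hL : IsCompact L) (hKL : Disjoint L (holomorphicHull E K)) :
    ∃ u : X → ℝ, IsPSHBump E K u ∧ ∀ p ∈ L, IsLargeStrictAt E u p := by
  refine hL.induction_on (p := fun s => ∃ u : X → ℝ, IsPSHBump E K u ∧
    ∀ p ∈ s, IsLargeStrictAt E u p) ⟨_, IsPSHBump.zero K, fun _ h => h.elim⟩ ?_ ?_ ?_
  · rintro s t hst ⟨u, hu, hut⟩
    exact ⟨u, hu, fun p hp => hut p (hst hp)⟩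
  · rintro s t ⟨u, hu, hus⟩ ⟨v, hv, hvt⟩
    refine ⟨_, hu.add hv, fun p hp => hp.elim (fun h => hu.isLargeStrictAt_add hv (hus p h))
      fun h => ?_⟩
    simpa only [add_comm] using hv.isLargeStrictAt_add hu (hvt p h)
  · intro z hz
    obtain ⟨u, hu, huz⟩ := hX.exists_isPSHBump_nhds hK (disjoint_left.1 hKL hz)
    exact ⟨_, mem_nhdsWithin_of_mem_nhds huz, u, hu, fun p hp => hp⟩

omit [IsManifold 𝓘(ℂ, E) ω X] in
theorem holomorphicHull_empty : holomorphicHull E (∅ : Set X) = ∅ := by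
  refine eq_empty_of_forall_notMem fun z hz => ?_
  have h := hz (fun _ => 1) contMDiff_const
  norm_num at h

/-- A Stein manifold has a smooth strictly plurisubharmonic exhaustion. It is the locally finite
sum of functions `v n ≥ 0` that vanish on the `n`-th set of an exhaustion by compact sets, and are
strictly plurisubharmonic and at least `n + 1` on compact sets that cover the manifold. -/
theorem IsStein.exists_isStrictlyPSHExhaustion [FiniteDimensional ℂ E] [T2Space X]
    [SecondCountableTopology X] (hX : IsStein E X) :
    ∃ φ : X → ℝ, IsStrictlyPSHExhaustion E φ := by
  have hlc : LocallyCompactSpace X := Manifold.locallyCompact_of_finiteDimensional 𝓘(ℂ, E)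
  set K : CompactExhaustion X := (CompactExhaustion.choice X).shiftr
  have hK0 : K 0 = ∅ := rfl
  -- the choice `m = 0` for `n = 0` makes the shells `K (g (m + 1)) \ K (g m)` cover the manifold
  have hg : ∀ n, ∃ m, holomorphicHull E (K n) ⊆ interior (K m) ∧ n ≤ m ∧ (n = 0 → m = 0) := by
    intro n
    rcases Nat.eq_zero_or_pos n with rfl | hn
    · exact ⟨0, by rw [hK0, holomorphicHull_empty]; exact empty_subset _, le_rfl, fun _ => rfl⟩
    · obtain ⟨m, hm⟩ := K.exists_superset_of_isCompact (hX.convexity _ (K.isCompact n))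
      exact ⟨max (m + 1) n, hm.trans (K.subset_interior (by omega)), le_max_right _ _,
        fun h => absurd h hn.ne'⟩
  choose g hgK hgn hg0 using hg
  have hu : ∀ n, ∃ u : X → ℝ, IsPSHBump E (K n) u ∧
      ∀ p ∈ K (g (n + 1)) \ interior (K (g n)), IsLargeStrictAt E u p := fun n =>
    hX.exists_isPSHBump_of_isCompact (K.isCompact n) ((K.isCompact _).diff isOpen_interior)
      (disjoint_left.2 fun p hp hp' => hp.2 (hgK n hp'))
  choose u hu hus using hu
  have hv : ∀ n : ℕ, IsPSHBump E (K n) (fun p => ((n : ℝ) + 1) * u n p) := fun n =>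
    (hu n).const_mul (by positivity)
  set v : ℕ → X → ℝ := fun n p => ((n : ℝ) + 1) * u n p with hvdef
  -- with `m + 1` the least index such that `x ∈ K (g (m + 1))`, `v m` is large and strict at `x`
  have hcover : ∀ x, ∃ m, x ∈ K (g (m + 1)) ∧ (m : ℝ) + 1 ≤ v m x ∧
      ∀ w : E, w ≠ 0 → 0 < leviAt E (v m) x w := by
    intro x
    have hex : ∃ n, x ∈ K (g n) := by
      obtain ⟨n, hn⟩ := K.exists_mem x
      exact ⟨n, K.subset (hgn n) hn⟩
    classical
    obtain ⟨m, hm⟩ : ∃ m, Nat.find hex = m + 1 := by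
      refine Nat.exists_eq_succ_of_ne_zero fun h0 => ?_
      have := Nat.find_spec hex
      rw [h0, hg0 0 rfl, hK0] at this
      exact this
    have hx1 : x ∈ K (g (m + 1)) := hm ▸ Nat.find_spec hex
    have hx2 : x ∉ K (g m) := Nat.find_min hex (by omega)
    obtain ⟨h1, h2⟩ := hus m x ⟨hx1, fun h => hx2 (interior_subset h)⟩
    have hm0 : (0 : ℝ) < m + 1 := by positivity
    refine ⟨m, hx1, le_mul_of_one_le_right hm0.le h1, fun w hw => ?_⟩
    rw [hvdef, leviAt_const_mul _ (hu m).smooth]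
    exact mul_pos hm0 (h2 w hw)
  set φ : X → ℝ := fun x => ∑' n, v n x with hφdef
  have hφ : ∀ N, ∀ x ∈ K N, φ x = ∑ n ∈ Finset.range N, v n x := fun N x hx =>
    tsum_eq_sum fun n hn => (hv n).eq_zero x (K.subset (by simpa using hn) hx)
  have hφloc : ∀ x, ∃ N, x ∈ K N ∧ φ =ᶠ[𝓝 x] fun p => ∑ n ∈ Finset.range N, v n p := by
    intro x
    obtain ⟨N, hN⟩ := K.exists_mem_nhds x
    exact ⟨N, mem_of_mem_nhds hN, by filter_upwards [hN] with p hp using hφ N p hp⟩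
  have hlt : ∀ {N m : ℕ} {x : X}, x ∈ K N → (m : ℝ) + 1 ≤ v m x → m ∈ Finset.range N := by
    intro N m x hx hm
    by_contra h
    have h0 := (hv m).eq_zero x (K.subset (by simpa using h) hx)
    have : (0 : ℝ) ≤ m := m.cast_nonneg
    change v m x = 0 at h0
    linarith
  have hφs : ContMDiff 𝓘(ℝ, E) 𝓘(ℝ, ℝ) ∞ φ := by
    intro x
    obtain ⟨N, -, hN⟩ := hφloc x
    exact (contMDiff_finsetSum (fun n _ => (hv n).smooth) x).congr_of_eventuallyEq hN
  refine ⟨φ, isSmoothStrictlyPSH_iff.2 ⟨hφs, fun x w hw => ?_⟩, fun c => ?_⟩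
  · change 0 < leviAt E φ x w
    obtain ⟨N, hxN, hN⟩ := hφloc x
    obtain ⟨m, -, hm1, hm2⟩ := hcover x
    rw [leviAt_congr hN, leviAt_finsetSum _ fun n => (hv n).smooth]
    exact Finset.sum_pos' (fun n _ => (hv n).levi_nonneg x w) ⟨m, hlt hxN hm1, hm2 w hw⟩
  · have hC : IsCompact (⋃ m ∈ Finset.range ⌈c⌉₊, K (g (m + 1))) :=
      (Finset.range ⌈c⌉₊).isCompact_biUnion fun m _ => K.isCompact _
    refine hC.of_isClosed_subset isClosed_closure
      (closure_minimal (fun x (hx : φ x < c) => ?_) hC.isClosed)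
    obtain ⟨m, hxm, hm1, -⟩ := hcover x
    obtain ⟨N, hN⟩ := K.exists_mem x
    have h1 : v m x ≤ φ x := by
      rw [hφ N x hN]
      exact Finset.single_le_sum (f := fun n => v n x) (fun n _ => (hv n).nonneg x) (hlt hN hm1)
    refine mem_biUnion (Finset.mem_coe.2 (Finset.mem_range.2 (Nat.lt_ceil.2 ?_))) hxm
    linarith

end Stein

end SteinLiouville

end

open SteinLiouville in
theorem mainTheorem3
    {E : Type*} [NormedAddCommGroup E] [NormedSpace ℂ E] [FiniteDimensional ℂ E]
    {X : Type*} [TopologicalSpace X] [T2Space X] [SecondCountableTopology X]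
    [ChartedSpace E X] [IsManifold 𝓘(ℂ, E) ω X]
    (hX : IsStein E X) :
    -- every smooth strictly plurisubharmonic exhaustion
    (∀ φ : X → ℝ, IsStrictlyPSHExhaustion E φ →
      IsExactSymplectic (liouvilleForm E φ) ∧ IsExhausting E φ ∧
      ∃ Z : VField E X, IsLiouvilleField (liouvilleForm E φ) Z ∧ HasPositiveLevels φ Z ∧
        (IsCompact (criticalSet E φ) → IsPositiveOutsideCompact φ Z)) ∧
    -- the Stein manifold is a Liouville manifold
    (∃ φ : X → ℝ, IsStrictlyPSHExhaustion E φ ∧ IsLiouvilleManifold (liouvilleForm E φ)) ∧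
    -- the finite type case
    ((∃ φ : X → ℝ, IsStrictlyPSHExhaustion E φ ∧ IsCompact (criticalSet E φ)) →
      ∃ φ : X → ℝ, IsStrictlyPSHExhaustion E φ ∧ IsCompact (criticalSet E φ) ∧
        IsFiniteTypeLiouvilleManifold (liouvilleForm E φ)) := by
  refine ⟨fun φ hφ => ⟨isExactSymplectic_liouvilleForm hφ.strictlyPSH, hφ.isExhausting,
    liouvilleField E φ, isLiouvilleField_liouvilleField hφ.strictlyPSH,
    hasPositiveLevels_of_isLiouvilleField hφ.strictlyPSH
      (isLiouvilleField_liouvilleField hφ.strictlyPSH),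
    fun hc => ⟨criticalSet E φ, hc, fun x hx => derivAlong_pos hφ.strictlyPSH
      (isLiouvilleField_liouvilleField hφ.strictlyPSH) hx⟩⟩, ?_, ?_⟩
  · obtain ⟨φ, hφ⟩ := hX.exists_isStrictlyPSHExhaustion
    exact ⟨fun p => Real.exp (φ p), hφ.exp, _, _, hφ.isLiouvilleWith_exp⟩
  · rintro ⟨φ, hφ, hc⟩
    rw [← criticalSet_exp hφ.strictlyPSH.smooth] at hc
    exact ⟨fun p => Real.exp (φ p), hφ.exp, hc, _, _, hφ.isLiouvilleWith_exp,
      criticalSet E (fun p => Real.exp (φ p)), hc, fun x hx =>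
        derivAlong_pos hφ.exp.strictlyPSH hφ.isLiouvilleWith_exp.liouvilleField hx⟩
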